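/- For \(\alpha\in(0,1)\) let \(T_\alpha:[0,1]\to[0,1]\) be the Pomeau–Manneville map \(T_\alpha(x)=x(1+2^\alpha x^\alpha)\) for \(x\in[0,1/2)\) and \(T_\alpha(x)=2x-1\) for \(x\in[1/2,1]\). Let \(m\) be Lebesgue measure on \([0,1]\), and for \(\beta\in(0,1)\) let \[ \mathcal C_*(\beta)=\{f\in C((0,1])\cap L^1(m):\ f\ge 0,\ f \text{ decreasing},\ x^{\beta+1}f \text{ increasing},\ f(x)\le 2^{\beta}(2+\beta)x^{-\beta}m(f)\} \] (monotonicity is meant in the weak sense). For \(F:[0,1]^{k+1}\to\mathbb R\) let \(\mathrm{Lip}(F;i)\) be the supremum of \(|F(y)-F(y')|/|y_i-y'_i|\) over all \(y,y'\) that differ exactly in the \(i\)th coordinate \((1\le i\le k+1)\), and call \(F\) Lipschitz in the \(i\)th coordinate if \(\mathrm{Lip}(F;i)<\infty\); let \(\|F\|_\infty=\sup|F|\). Theorem. Let \(\beta_*\in(0,1)\). There is a constant \(C>0\), depending only on \(\beta_*\), such that the following holds. Let \((\alpha_n)_{n\ge1}\) be any sequence in \((0,1)\) with \(\alpha_n\le\beta_*\)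 for all \(n\ge 1\), and put \(\widetilde T_n=T_{\alpha_n}\circ\cdots\circ T_{\alpha_1}\), \(\widetilde T_0=\mathrm{id}\). Let \(p\ge1\), and let \(0=n_0\le n_1\le\dots\le n_k\) and \(1\le l_1<\dots<l_p<k\) be integers. Let \(F:[0,1]^{k+1}\to\mathbb R\) be a bounded Borel function which is Lipschitz in the \(i\)th coordinate for each \(1\le i\le l_p+1\), and let \[ H(x_0,\dots,x_p)=F\bigl(x_0,\widetilde T_{n_1}(x_0),\dots,\widetilde T_{n_{l_1}}(x_0),\widetilde T_{n_{l_1+1}}(x_1),\dots,\widetilde T_{n_{l_2}}(x_1),\dots,\widetilde T_{n_{l_p+1}}(x_p),\dots,\widetilde T_{n_k}(x_p)\bigr). \] Let \(M\ge1\) be the largest number of indices \(i\in\{0,\dots,l_p\}\) that lie in one and the same of the blocks \(\{0,\dots,l_1\},\{l_1+1,\dots,l_2\},\dots,\{l_{p-1}+1,\dots,l_p\}\) and have the same value \(n_i\); in particular \(M=1\) if the \(n_i\) are distinct within each of these blocks. Then, for any probability measures \(\mu,\mu_1,\dots,\mu_p\) on \([0,1]\) with densities in \(\mathcal C_*(\beta_*)\),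 \[ \left|\int H(x,\dots,x)\,d\mu(x)-\int\!\cdots\!\int H(x_0,\dots,x_p)\,d\mu(x_0)\,d\mu_1(x_1)\cdots d\mu_p(x_p)\right| \le C\Bigl(\|F\|_\infty+M\max_{1\le i\le l_p+1}\mathrm{Lip}(F;i)\Bigr)\sum_{i=1}^p\rho(n_{l_i+1}-n_{l_i}), \] where \(\rho(0)=\rho(1)=1\) and \(\rho(n)=n^{1-1/\beta_*}(\log n)^{1/\beta_*}\) for \(n\ge2\). -/

import Mathlib

open MeasureTheory Set
open scoped unitInterval

noncomputable section

namespace PomeauManneville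

/-- The real formula `x (1 + 2^α x^α)` on `[0,1/2)` and `2x - 1` on `[1/2,1]`. -/
def mapReal (α x : ℝ) : ℝ :=
  if x < 1 / 2 then x * (1 + (2 : ℝ) ^ α * x ^ α) else 2 * x - 1

theorem mapReal_mem {α x : ℝ} (hα : 0 < α) (hx : x ∈ Icc (0 : ℝ) 1) :
    mapReal α x ∈ Icc (0 : ℝ) 1 := by
  obtain ⟨h0, h1⟩ := hx
  unfold mapReal
  split_ifs with h
  · have e : (2 : ℝ) ^ α * x ^ α = (2 * x) ^ α := (Real.mul_rpow (by norm_num) h0).symm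
    have hp : 0 ≤ (2 * x) ^ α := by positivity
    have hle : (2 * x) ^ α ≤ 1 := Real.rpow_le_one (by linarith) (by linarith) hα.le
    rw [e]
    constructor
    · positivity
    · nlinarith
  · constructor <;> linarith

/-- The Pomeau–Manneville map `T_α : [0,1] → [0,1]`, for `α ∈ (0,1)`. -/
def pmMap (α : Ioo (0 : ℝ) 1) (x : I) : I :=
  ⟨mapReal α x, mapReal_mem α.2.1 x.2⟩

/-- The composition `T_{α n} ∘ ⋯ ∘ T_{α 1}` (the identity for `n = 0`; `α 0` is not used). -/
def comp (α : ℕ → Ioo (0 : ℝ) 1) : ℕ → I → I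
  | 0 => id
  | n + 1 => pmMap (α (n + 1)) ∘ comp α n

/-- The cone `C_*(β)`. A function in `C((0,1]) ∩ L¹` is represented by a function on `[0,1]` whose
value at `0` is irrelevant; `volume` is the Lebesgue measure `m` on `[0,1]`. -/
structure InCone (β : ℝ) (f : I → ℝ) : Prop where
  continuousOn : ContinuousOn f (Ioc 0 1)
  integrable : Integrable f volume
  nonneg : ∀ x ∈ Ioc (0 : I) 1, 0 ≤ f x
  antitoneOn : AntitoneOn f (Ioc 0 1)
  monotoneOn : MonotoneOn (fun x : I => (x : ℝ) ^ (β + 1) * f x) (Ioc 0 1)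
  le_rpow : ∀ x ∈ Ioc (0 : I) 1,
    f x ≤ (2 : ℝ) ^ β * (2 + β) * (x : ℝ) ^ (-β) * ∫ y, f y

/-- `μ` has a density (with respect to Lebesgue measure) belonging to `C_*(β)`. -/
def HasDensityInCone (β : ℝ) (μ : Measure I) : Prop :=
  ∃ h : I → ℝ, InCone β h ∧ μ = volume.withDensity (fun x => ENNReal.ofReal (h x))

/-- The rate function: `ρ(0) = ρ(1) = 1` and `ρ(n) = n^(1 - 1/β) (log n)^(1/β)` for `n ≥ 2`. -/
def rho (β : ℝ) (n : ℕ) : ℝ :=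
  if n ≤ 1 then 1 else (n : ℝ) ^ (-(1 / β) + 1) * (Real.log n) ^ (1 / β)

/-- The supremum norm (meaningful for bounded `F`). -/
def supNorm {k : ℕ} (F : (Fin (k + 1) → I) → ℝ) : ℝ := ⨆ y, |F y|

/-- The difference quotients of `F` in the coordinate `i`, all other coordinates being fixed. -/
def coordQuotients {k : ℕ} (F : (Fin (k + 1) → I) → ℝ) (i : Fin (k + 1)) : Set ℝ :=
  {r | ∃ (y : Fin (k + 1) → I) (a b : I), a ≠ b ∧
    r = |F (Function.update y i a) - F (Function.update y i b)| / |(a : ℝ) - b|}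

/-- `F` is Lipschitz continuous in the coordinate `i`. -/
def LipschitzInCoord {k : ℕ} (F : (Fin (k + 1) → I) → ℝ) (i : Fin (k + 1)) : Prop :=
  BddAbove (coordQuotients F i)

/-- The Lipschitz constant of `F` in the coordinate `i` (meaningful if it is finite). -/
def lipCoord {k : ℕ} (F : (Fin (k + 1) → I) → ℝ) (i : Fin (k + 1)) : ℝ :=
  sSup (coordQuotients F i)

/-- The maximum of the Lipschitz constants of `F` in the coordinates `0, …, q`
(the first `q + 1` coordinates, counted from `0`). -/
def maxLip {k : ℕ} (F : (Fin (k + 1) → I) → ℝ) (q : ℕ) : ℝ :=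
  ⨆ i : {i : Fin (k + 1) // (i : ℕ) ≤ q}, lipCoord F i

/-- The index `j ∈ {0, …, p}` of the variable `x_j` that enters the coordinate `i` of `F`:
the number of `j ∈ {1, …, p}` with `l j < i`. Thus it is `0` for `i ≤ l 1`, it is `j` for
`l j < i ≤ l (j + 1)`, and `p` for `l p < i`. -/
def block (p : ℕ) (l : ℕ → ℕ) (i : ℕ) : Fin (p + 1) :=
  ⟨((Finset.Icc 1 p).filter (fun j => l j < i)).card, by
    have h := Finset.card_filter_le (Finset.Icc 1 p) (fun j => l j < i)
    simp only [Nat.card_Icc] at h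
    omega⟩

/-- The function `H(x_0, …, x_p)`, whose value is `F` at the point with coordinates
`T̃_{n i} (x_{block i})`, `i = 0, …, k`. -/
def composed {k : ℕ} (α : ℕ → Ioo (0 : ℝ) 1) (n : ℕ → ℕ) (p : ℕ) (l : ℕ → ℕ)
    (F : (Fin (k + 1) → I) → ℝ) (x : Fin (p + 1) → I) : ℝ :=
  F (fun i => comp α (n i) (x (block p l i)))

/-- The largest number of coordinates among the first `l p + 1` ones into which `H` inserts one
and the same expression `T̃_{n i} (x_j)`. It is `1` if the times are distinct in each block. -/
def timeMultiplicity (n : ℕ → ℕ) (p : ℕ) (l : ℕ → ℕ) : ℕ :=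
  (Finset.range (l p + 1)).sup fun i =>
    ((Finset.range (l p + 1)).filter
      (fun i' => n i' = n i ∧ block p l i' = block p l i)).card

end PomeauManneville

end

/-!
The proof replaces bounded distortion by one invariant class of densities. Call a density on `(0, 1]`
*tame* if it decreases while `x ^ 2 * f x` increases (`Tame`); since all exponents are at most `1`,
both inverse branches of every map preserve this class (`Tame.opL`, `Tame.opR`). The right branch
moreover flattens: what it transports varies by a factor at most `4` (`Tame.opR_le`). Hence tame
densities carried along any itinerary that ends with the right branch are comparable to constants.
The tame densities with `f x ≤ A x ^ (-β) ∫ f` form a cone that is invariant under all transfer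
operators, provided that `A` is large (`Cone.tr`), and whose members are bounded below by a
multiple of their mass (`exists_cone_lower_bound`).

Two points with the same itinerary during `N` steps are `O(N ^ (-1/β))` apart, because a distance
`d` grows to at least `d (1 + (2d) ^ β)` in each step (`dist_le_diamBound`). Therefore `(0, 1]`
splits into *cells*, the sets with a given itinerary during `Q` steps, followed by a first right
branch within the next `m` steps, and a remainder of mass `O(m ^ (1 - 1/β))`
(`integral_eq_sum_cell`, `Cone.setIntegral_tail_le`).

Loss of memory: during `2q` steps each cell (with `Q = m = q`) spreads over the interval
(`exists_cell_minorization`), and the difference of two cone densities is almost constant on the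
cells. So its `L¹` norm contracts by a fixed factor, up to an error `O(q ^ (1 - 1/β))`
(`exists_block_contraction`). Iterating this about `log n` times with `q` of order `n / log n`
gives the rate `rho` (`exists_memory_loss`).

Correlations: across a gap of length `m` after the time `t`, take the cells of prefix length
`t + m / 4`. At the times `n i ≤ t` their images are so short that the corresponding coordinates of
`F` may be frozen, with a total error of at most a constant times `M Lip(F) ∑_{r ≥ m/4} r ^ (-1/β)`;
at the end of the cell the transported density is in the cone again, so that loss of memory applies
to the rest of the gap (`exists_gap_bound`). The theorem follows by introducing the independent
variables block by block, from the left. At each stage only the coordinates of one block are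
frozen, which is why coinciding times need only be counted within blocks.
-/


namespace PomeauManneville

/-! ### The two branches of the map -/

/-- The left branch `x (1 + (2x)^a)` of the map, as a bijection of `(0, 1/2]` onto `(0, 1]`. -/
noncomputable def leftBranch (a x : ℝ) : ℝ := x * (1 + (2 * x) ^ a)

theorem mapReal_of_lt {a x : ℝ} (h0 : 0 ≤ x) (h : x < 1 / 2) :
    mapReal a x = leftBranch a x := by
  unfold mapReal leftBranch
  rw [if_pos h, Real.mul_rpow (by norm_num) h0]

theorem mapReal_of_ge {a x : ℝ} (h : 1 / 2 ≤ x) : mapReal a x = 2 * x - 1 :=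
  if_neg (not_lt.2 h)

theorem measurable_mapReal (a : ℝ) : Measurable (mapReal a) := by
  unfold mapReal
  exact Measurable.ite measurableSet_Iio (by fun_prop) (by fun_prop)

/-- Distances grow under the left branch at least as they do at the fixed point `0`. -/
theorem leftBranch_sub {a x y : ℝ} (ha : 0 < a) (h0 : 0 ≤ x) (hxy : x ≤ y) :
    leftBranch a (y - x) ≤ leftBranch a y - leftBranch a x := by
  have h1 : (2 * x) ^ a ≤ (2 * y) ^ a := by
    apply Real.rpow_le_rpow <;> linarith
  have h2 : (2 * (y - x)) ^ a ≤ (2 * y) ^ a := by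
    apply Real.rpow_le_rpow <;> linarith
  unfold leftBranch
  nlinarith [mul_le_mul_of_nonneg_left h2 (sub_nonneg.2 hxy), mul_le_mul_of_nonneg_left h1 h0]

theorem leftBranch_strictMonoOn {a : ℝ} (ha : 0 < a) : StrictMonoOn (leftBranch a) (Ici 0) := by
  intro x hx y hy hxy
  have h := leftBranch_sub ha hx hxy.le
  have : 0 < leftBranch a (y - x) := by
    have : 0 < y - x := sub_pos.2 hxy
    unfold leftBranch
    positivity
  linarith

theorem leftBranch_half {a : ℝ} : leftBranch a (1 / 2) = 1 := by
  unfold leftBranch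
  norm_num

theorem leftBranch_zero {a : ℝ} : leftBranch a 0 = 0 := by
  simp [leftBranch]

theorem continuous_leftBranch {a : ℝ} (ha : 0 < a) : Continuous (leftBranch a) := by
  unfold leftBranch
  exact continuous_id.mul (continuous_const.add
    ((continuous_const.mul continuous_id).rpow_const fun _ => Or.inr ha.le))

/-- The inverse of the left branch, meaningful on `(0, 1]`. -/
noncomputable def leftInv (a x : ℝ) : ℝ := Function.invFunOn (leftBranch a) (Ioc 0 (1 / 2)) x

theorem exists_leftBranch_eq {a x : ℝ} (ha : 0 < a) (hx : x ∈ Ioc (0 : ℝ) 1) :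
    ∃ y ∈ Ioc (0 : ℝ) (1 / 2), leftBranch a y = x := by
  have h := intermediate_value_Icc (show (0 : ℝ) ≤ 1 / 2 by norm_num)
    (continuous_leftBranch ha).continuousOn
  rw [leftBranch_half, leftBranch_zero] at h
  obtain ⟨y, hy, rfl⟩ := h ⟨hx.1.le, hx.2⟩
  refine ⟨y, ⟨lt_of_le_of_ne hy.1 ?_, hy.2⟩, rfl⟩
  rintro rfl
  rw [leftBranch_zero] at hx
  exact lt_irrefl _ hx.1

theorem leftInv_mem {a x : ℝ} (ha : 0 < a) (hx : x ∈ Ioc (0 : ℝ) 1) :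
    leftInv a x ∈ Ioc (0 : ℝ) (1 / 2) :=
  Function.invFunOn_mem (exists_leftBranch_eq ha hx)

theorem leftBranch_leftInv {a x : ℝ} (ha : 0 < a) (hx : x ∈ Ioc (0 : ℝ) 1) :
    leftBranch a (leftInv a x) = x :=
  Function.invFunOn_eq (exists_leftBranch_eq ha hx)

theorem leftBranch_mem {a y : ℝ} (ha : 0 < a) (hy : y ∈ Ioc (0 : ℝ) (1 / 2)) :
    leftBranch a y ∈ Ioc (0 : ℝ) 1 := by
  have hm := leftBranch_strictMonoOn ha
  constructor
  · rw [← leftBranch_zero (a := a)]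
    exact hm (mem_Ici.2 le_rfl) hy.1.le hy.1
  · rw [← leftBranch_half (a := a)]
    exact hm.monotoneOn hy.1.le (by norm_num : (1 / 2 : ℝ) ∈ Ici 0) hy.2

theorem leftInv_leftBranch {a y : ℝ} (ha : 0 < a) (hy : y ∈ Ioc (0 : ℝ) (1 / 2)) :
    leftInv a (leftBranch a y) = y := by
  have h := leftBranch_mem ha hy
  exact (leftBranch_strictMonoOn ha).injOn (leftInv_mem ha h).1.le hy.1.le
    (leftBranch_leftInv ha h)

theorem leftInv_mono {a x x' : ℝ} (ha : 0 < a) (hx : x ∈ Ioc (0 : ℝ) 1)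
    (hx' : x' ∈ Ioc (0 : ℝ) 1) (h : x ≤ x') : leftInv a x ≤ leftInv a x' := by
  rw [← (leftBranch_strictMonoOn ha).le_iff_le (leftInv_mem ha hx).1.le (leftInv_mem ha hx').1.le,
    leftBranch_leftInv ha hx, leftBranch_leftInv ha hx']
  exact h

theorem hasDerivAt_leftBranch {a x : ℝ} (hx : 0 < x) :
    HasDerivAt (leftBranch a) (1 + (a + 1) * (2 * x) ^ a) x := by
  have h1 : HasDerivAt (fun x : ℝ => 2 * x) 2 x := by
    simpa using (hasDerivAt_id x).const_mul 2
  have h2 := ((h1.rpow_const (p := a) (Or.inl (by positivity))).const_add 1)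
  have h3 := (hasDerivAt_id x).mul h2
  refine h3.congr_deriv ?_
  have : (2 * x) ^ a = (2 * x) ^ (a - 1) * (2 * x) := by
    rw [← Real.rpow_add_one (by positivity)]
    congr 1
    ring
  simp only [id]
  rw [this]
  ring

/-- Lebesgue measure on `(0, 1]`. -/
noncomputable def unitVol : Measure ℝ := volume.restrict (Ioc 0 1)

instance : IsProbabilityMeasure unitVol := ⟨by simp [unitVol]⟩

theorem ae_unitVol_mem : ∀ᵐ x ∂unitVol, x ∈ Ioc (0 : ℝ) 1 :=
  ae_restrict_mem measurableSet_Ioc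

/-- The contribution of the left branch to the transfer operator. -/
noncomputable def opL (a : ℝ) (f : ℝ → ℝ) (x : ℝ) : ℝ :=
  f (leftInv a x) / (1 + (a + 1) * (2 * leftInv a x) ^ a)

/-- The contribution of the right branch to the transfer operator. -/
noncomputable def opR (f : ℝ → ℝ) (x : ℝ) : ℝ := f ((x + 1) / 2) / 2

theorem unitVol_restrict_Iio : unitVol.restrict (Iio (1 / 2)) = volume.restrict (Ioo 0 (1 / 2)) := by
  rw [unitVol, Measure.restrict_restrict measurableSet_Iio]
  congr 1
  ext x
  simp only [mem_inter_iff, mem_Iio, mem_Ioc, mem_Ioo]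
  constructor
  · rintro ⟨h, h', -⟩; exact ⟨h', h⟩
  · rintro ⟨h, h'⟩; exact ⟨h', h, by linarith⟩

theorem unitVol_restrict_Ici : unitVol.restrict (Ici (1 / 2)) = volume.restrict (Icc (1 / 2) 1) := by
  rw [unitVol, Measure.restrict_restrict measurableSet_Ici]
  congr 1
  ext x
  simp only [mem_inter_iff, mem_Ici, mem_Ioc, mem_Icc]
  constructor
  · rintro ⟨h, -, h'⟩; exact ⟨h, h'⟩
  · rintro ⟨h, h'⟩; exact ⟨h, by linarith, h'⟩

theorem unitVol_eq_Ioo : unitVol = volume.restrict (Ioo 0 1) :=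
  Measure.restrict_congr_set Ioo_ae_eq_Ioc.symm

theorem unitVol_eq_Icc : unitVol = volume.restrict (Icc 0 1) :=
  Measure.restrict_congr_set Ioc_ae_eq_Icc

theorem image_leftBranch {a : ℝ} (ha : 0 < a) :
    leftBranch a '' Ioo 0 (1 / 2) = Ioo 0 1 := by
  have hm := leftBranch_strictMonoOn ha
  ext x
  constructor
  · rintro ⟨y, hy, rfl⟩
    refine ⟨(leftBranch_mem ha ⟨hy.1, hy.2.le⟩).1, ?_⟩
    rw [← leftBranch_half (a := a)]
    exact hm hy.1.le (by norm_num : (1 / 2 : ℝ) ∈ Ici 0) hy.2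
  · intro hx
    have hx' : x ∈ Ioc (0 : ℝ) 1 := ⟨hx.1, hx.2.le⟩
    refine ⟨leftInv a x, ⟨(leftInv_mem ha hx').1, lt_of_le_of_ne (leftInv_mem ha hx').2 ?_⟩,
      leftBranch_leftInv ha hx'⟩
    intro h
    have := leftBranch_leftInv ha hx'
    rw [h, leftBranch_half] at this
    exact hx.2.ne this.symm

theorem leftBranch_deriv_pos {a x : ℝ} (ha : 0 < a) (hx : 0 < x) :
    0 < 1 + (a + 1) * (2 * x) ^ a := by positivity

theorem opL_smul_aux {a : ℝ} (ha : 0 < a) (f ψ : ℝ → ℝ) {x : ℝ} (hx : x ∈ Ioo (0 : ℝ) (1 / 2)) :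
    |1 + (a + 1) * (2 * x) ^ a| • (opL a f (leftBranch a x) * ψ (leftBranch a x)) =
      f x * ψ (mapReal a x) := by
  have hp := leftBranch_deriv_pos ha hx.1
  rw [opL, leftInv_leftBranch ha ⟨hx.1, hx.2.le⟩, mapReal_of_lt hx.1.le hx.2, abs_of_pos hp,
    smul_eq_mul]
  field_simp

theorem integral_opL {a : ℝ} (ha : 0 < a) (f ψ : ℝ → ℝ) :
    ∫ x, opL a f x * ψ x ∂unitVol = ∫ x in Iio (1 / 2), f x * ψ (mapReal a x) ∂unitVol := by
  rw [unitVol_restrict_Iio, unitVol_eq_Ioo, ← image_leftBranch ha,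
    integral_image_eq_integral_abs_deriv_smul measurableSet_Ioo
      (fun x hx => (hasDerivAt_leftBranch hx.1).hasDerivWithinAt)
      ((leftBranch_strictMonoOn ha).injOn.mono fun x hx => hx.1.le)]
  exact setIntegral_congr_fun measurableSet_Ioo fun x hx => opL_smul_aux ha f ψ hx

theorem integrable_opL {a : ℝ} (ha : 0 < a) {f : ℝ → ℝ} (hf : Integrable f unitVol) :
    Integrable (opL a f) unitVol := by
  have h : IntegrableOn (opL a f) (leftBranch a '' Ioo 0 (1 / 2)) := by
    rw [integrableOn_image_iff_integrableOn_abs_deriv_smul measurableSet_Ioo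
      (fun x hx => (hasDerivAt_leftBranch hx.1).hasDerivWithinAt)
      ((leftBranch_strictMonoOn ha).injOn.mono fun x hx => hx.1.le)]
    refine IntegrableOn.congr_fun (f := f) ?_ (fun x hx => ?_) measurableSet_Ioo
    · have := hf.restrict (s := Iio (1 / 2))
      rwa [unitVol_restrict_Iio] at this
    · simpa using (opL_smul_aux ha f (fun _ => 1) hx).symm
  rw [image_leftBranch ha] at h
  rwa [unitVol_eq_Ioo]

theorem image_rightBranch : (fun x : ℝ => 2 * x - 1) '' Icc (1 / 2) 1 = Icc 0 1 := by
  ext x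
  constructor
  · rintro ⟨y, hy, rfl⟩
    constructor <;> linarith [hy.1, hy.2]
  · intro hx
    exact ⟨(x + 1) / 2, ⟨by linarith [hx.1], by linarith [hx.2]⟩, by ring⟩

theorem hasDerivAt_rightBranch (x : ℝ) : HasDerivAt (fun x : ℝ => 2 * x - 1) 2 x := by
  simpa using ((hasDerivAt_id x).const_mul 2).sub_const 1

theorem injOn_rightBranch (s : Set ℝ) : InjOn (fun x : ℝ => 2 * x - 1) s := by
  intro x _ y _ h
  simp only at h
  linarith

theorem opR_smul_aux {a : ℝ} (f ψ : ℝ → ℝ) {x : ℝ} (hx : x ∈ Icc (1 / 2 : ℝ) 1) :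
    |(2 : ℝ)| • (opR f (2 * x - 1) * ψ (2 * x - 1)) = f x * ψ (mapReal a x) := by
  rw [opR, mapReal_of_ge hx.1, abs_of_pos two_pos, smul_eq_mul,
    show (2 * x - 1 + 1) / 2 = x by ring]
  ring

theorem integral_opR (a : ℝ) (f ψ : ℝ → ℝ) :
    ∫ x, opR f x * ψ x ∂unitVol = ∫ x in Ici (1 / 2), f x * ψ (mapReal a x) ∂unitVol := by
  rw [unitVol_restrict_Ici, unitVol_eq_Icc, ← image_rightBranch,
    integral_image_eq_integral_abs_deriv_smul measurableSet_Icc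
      (fun x _ => (hasDerivAt_rightBranch x).hasDerivWithinAt) (injOn_rightBranch _)]
  exact setIntegral_congr_fun measurableSet_Icc fun x hx => opR_smul_aux f ψ hx

theorem integrable_opR {f : ℝ → ℝ} (hf : Integrable f unitVol) : Integrable (opR f) unitVol := by
  have h : IntegrableOn (opR f) ((fun x : ℝ => 2 * x - 1) '' Icc (1 / 2) 1) := by
    rw [integrableOn_image_iff_integrableOn_abs_deriv_smul measurableSet_Icc
      (fun x _ => (hasDerivAt_rightBranch x).hasDerivWithinAt) (injOn_rightBranch _)]
    refine IntegrableOn.congr_fun (f := f) ?_ (fun x hx => ?_) measurableSet_Icc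
    · have := hf.restrict (s := Ici (1 / 2))
      rwa [unitVol_restrict_Ici] at this
    · simpa using (opR_smul_aux (a := 1) f (fun _ => 1) hx).symm
  rw [image_rightBranch] at h
  rwa [unitVol_eq_Icc]

/-! ### Tame densities and the cone -/

/-- Nonnegative integrable densities on `(0, 1]` that decrease while `x ^ 2 * f x` increases.
The exponent `2` replaces the exponents `β + 1 ≤ 2`; this class is preserved by each branch. -/
structure Tame (f : ℝ → ℝ) : Prop where
  nonneg : ∀ x ∈ Ioc (0 : ℝ) 1, 0 ≤ f x
  anti : AntitoneOn f (Ioc 0 1)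
  mono : MonotoneOn (fun x => x ^ 2 * f x) (Ioc 0 1)
  integrable : Integrable f unitVol

theorem tame_one : Tame fun _ => 1 where
  nonneg _ _ := zero_le_one
  anti _ _ _ _ _ := le_rfl
  mono x hx y _ hxy := by
    simp only [mul_one]
    exact pow_le_pow_left₀ hx.1.le hxy 2
  integrable := integrable_const _

theorem Tame.add {f g : ℝ → ℝ} (hf : Tame f) (hg : Tame g) : Tame fun x => f x + g x where
  nonneg x hx := add_nonneg (hf.nonneg x hx) (hg.nonneg x hx)
  anti x hx y hy h := add_le_add (hf.anti hx hy h) (hg.anti hx hy h)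
  mono x hx y hy h := by
    simp only [mul_add]
    exact add_le_add (hf.mono hx hy h) (hg.mono hx hy h)
  integrable := hf.integrable.add hg.integrable

theorem Tame.opL {a : ℝ} (ha : 0 < a) (ha1 : a ≤ 1) {f : ℝ → ℝ} (hf : Tame f) :
    Tame (opL a f) where
  nonneg x hx := by
    have h := leftInv_mem ha hx
    have := hf.nonneg _ ⟨h.1, h.2.trans (by norm_num)⟩
    have := leftBranch_deriv_pos ha h.1
    unfold PomeauManneville.opL
    positivity
  anti x hx x' hx' hxx := by
    have h := leftInv_mem ha hx
    have h' := leftInv_mem ha hx'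
    have hle := leftInv_mono ha hx hx' hxx
    have m : leftInv a x ∈ Ioc (0 : ℝ) 1 := ⟨h.1, h.2.trans (by norm_num)⟩
    have m' : leftInv a x' ∈ Ioc (0 : ℝ) 1 := ⟨h'.1, h'.2.trans (by norm_num)⟩
    unfold PomeauManneville.opL
    have := h.1
    have hr : (2 * leftInv a x) ^ a ≤ (2 * leftInv a x') ^ a := by
      apply Real.rpow_le_rpow <;> linarith
    apply div_le_div₀ (hf.nonneg _ m) (hf.anti m m' hle) (leftBranch_deriv_pos ha h.1)
    nlinarith
  mono x hx x' hx' hxx := by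
    have h := leftInv_mem ha hx
    have h' := leftInv_mem ha hx'
    have hle := leftInv_mono ha hx hx' hxx
    have m : leftInv a x ∈ Ioc (0 : ℝ) 1 := ⟨h.1, h.2.trans (by norm_num)⟩
    have m' : leftInv a x' ∈ Ioc (0 : ℝ) 1 := ⟨h'.1, h'.2.trans (by norm_num)⟩
    have e : ∀ z ∈ Ioc (0 : ℝ) 1, z ^ 2 * PomeauManneville.opL a f z =
        ((leftInv a z) ^ 2 * f (leftInv a z)) *
          ((1 + (2 * leftInv a z) ^ a) ^ 2 / (1 + (a + 1) * (2 * leftInv a z) ^ a)) := by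
      intro z hz
      have hz' := leftBranch_leftInv ha hz
      unfold PomeauManneville.opL
      rw [leftBranch] at hz'
      nth_rewrite 1 [← hz']
      ring
    simp only
    rw [e x hx, e x' hx']
    have := h.1
    have hr : (2 * leftInv a x) ^ a ≤ (2 * leftInv a x') ^ a := by
      apply Real.rpow_le_rpow <;> linarith
    have hu : 0 ≤ (2 * leftInv a x) ^ a := by positivity
    apply mul_le_mul (hf.mono m m' hle) _ _ (mul_nonneg (sq_nonneg _) (hf.nonneg _ m'))
    · rw [div_le_div_iff₀ (leftBranch_deriv_pos ha h.1) (leftBranch_deriv_pos ha h'.1)]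
      generalize (2 * leftInv a x) ^ a = u at *
      generalize (2 * leftInv a x') ^ a = v at *
      obtain ⟨w, rfl⟩ : ∃ w, v = u + w := ⟨v - u, by ring⟩
      have hw : 0 ≤ w := by linarith
      have h1 : 0 ≤ w * (1 + u) * (1 - a + (a + 1) * u) := by
        have : 0 ≤ 1 - a := by linarith
        positivity
      have h2 : 0 ≤ w ^ 2 * (1 + (a + 1) * u) := by positivity
      nlinarith
    · have := leftBranch_deriv_pos ha h.1
      positivity
  integrable := integrable_opL ha hf.integrable

theorem half_mem {x : ℝ} (hx : x ∈ Ioc (0 : ℝ) 1) : (x + 1) / 2 ∈ Ioc (0 : ℝ) 1 :=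
  ⟨by linarith [hx.1], by linarith [hx.2]⟩

theorem Tame.opR {f : ℝ → ℝ} (hf : Tame f) : Tame (opR f) where
  nonneg x hx := by
    have := hf.nonneg _ (half_mem hx)
    unfold PomeauManneville.opR
    positivity
  anti x hx x' hx' hxx := by
    have := hf.anti (half_mem hx) (half_mem hx') (by linarith)
    unfold PomeauManneville.opR
    linarith
  mono x hx x' hx' hxx := by
    have h := hf.mono (half_mem hx) (half_mem hx') (by linarith)
    have e : ∀ z ∈ Ioc (0 : ℝ) 1, z ^ 2 * PomeauManneville.opR f z =
        (((z + 1) / 2) ^ 2 * f ((z + 1) / 2)) * (2 * (z / (z + 1)) ^ 2) := by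
      intro z hz
      have : z + 1 ≠ 0 := by linarith [hz.1]
      unfold PomeauManneville.opR
      field_simp
    simp only
    rw [e x hx, e x' hx']
    have h1 : x / (x + 1) ≤ x' / (x' + 1) := by
      rw [div_le_div_iff₀ (by linarith [hx.1]) (by linarith [hx'.1])]
      nlinarith
    have h0 : 0 ≤ x / (x + 1) := div_nonneg hx.1.le (by linarith [hx.1])
    apply mul_le_mul h _ (by positivity)
      (mul_nonneg (sq_nonneg _) (hf.nonneg _ (half_mem hx')))
    have := pow_le_pow_left₀ h0 h1 2
    linarith
  integrable := integrable_opR hf.integrable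

theorem one_mem_Ioc : (1 : ℝ) ∈ Ioc (0 : ℝ) 1 := ⟨one_pos, le_rfl⟩

theorem Tame.integral_nonneg {f : ℝ → ℝ} (hf : Tame f) : 0 ≤ ∫ x, f x ∂unitVol :=
  integral_nonneg_of_ae (ae_unitVol_mem.mono fun x hx => hf.nonneg x hx)

/-- The right branch flattens: its output varies by a factor at most `4`. -/
theorem Tame.opR_le {f : ℝ → ℝ} (hf : Tame f) {x : ℝ} (hx : x ∈ Ioc (0 : ℝ) 1) :
    PomeauManneville.opR f x ≤ 4 * PomeauManneville.opR f 1 := by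
  have h := hf.mono (half_mem hx) one_mem_Ioc (half_mem hx).2
  have h0 := hf.nonneg _ (half_mem hx)
  unfold PomeauManneville.opR
  simp only at h
  have h2 : (1 : ℝ) / 4 ≤ ((x + 1) / 2) ^ 2 := by nlinarith [hx.1]
  have h3 := mul_le_mul_of_nonneg_right h2 h0
  norm_num at h ⊢
  linarith

theorem Tame.one_le_integral {f : ℝ → ℝ} (hf : Tame f) : f 1 ≤ ∫ x, f x ∂unitVol := by
  have : ∫ _, f 1 ∂unitVol ≤ ∫ x, f x ∂unitVol :=
    integral_mono_ae (integrable_const _) hf.integrable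
      (ae_unitVol_mem.mono fun x hx => hf.anti hx one_mem_Ioc hx.2)
  simpa using this

theorem Tame.integral_opR_le {f : ℝ → ℝ} (hf : Tame f) :
    ∫ x, PomeauManneville.opR f x ∂unitVol ≤ 4 * PomeauManneville.opR f 1 := by
  have : ∫ x, PomeauManneville.opR f x ∂unitVol ≤ ∫ _, 4 * PomeauManneville.opR f 1 ∂unitVol :=
    integral_mono_ae hf.opR.integrable (integrable_const _)
      (ae_unitVol_mem.mono fun x hx => hf.opR_le hx)
  simpa using this

/-- The constant of the upper bound in `Cone`. It exceeds `2 ^ β * (2 + β)`, and it is large enough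
for `Cone β` to be invariant under the transfer operators. -/
noncomputable def coneConst (β : ℝ) : ℝ := 3 / (1 - β) + 12

/-- Tame densities with a singularity at `0` of order at most `β`. -/
structure Cone (β : ℝ) (f : ℝ → ℝ) : Prop extends Tame f where
  le_rpow : ∀ x ∈ Ioc (0 : ℝ) 1, f x ≤ coneConst β * x ^ (-β) * ∫ y, f y ∂unitVol

theorem coneConst_ge {β : ℝ} (hβ1 : β < 1) : 12 ≤ coneConst β := by
  have : 0 < 1 - β := by linarith
  have : 0 ≤ 3 / (1 - β) := by positivity
  unfold coneConst
  linarith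

theorem one_le_rpow_neg {β x : ℝ} (hβ0 : 0 < β) (hx : x ∈ Ioc (0 : ℝ) 1) : 1 ≤ x ^ (-β) :=
  Real.one_le_rpow_of_pos_of_le_one_of_nonpos hx.1 hx.2 (by linarith)

theorem cone_of_le {β : ℝ} (hβ0 : 0 < β) (hβ1 : β < 1) {f : ℝ → ℝ} (hf : Tame f)
    (h : ∀ x ∈ Ioc (0 : ℝ) 1, f x ≤ 4 * f 1) : Cone β f where
  toTame := hf
  le_rpow x hx := by
    have h1 := h x hx
    have h2 := hf.one_le_integral
    have h3 := hf.integral_nonneg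
    have h4 := one_le_rpow_neg hβ0 hx
    have h5 := coneConst_ge hβ1
    have h6 : 4 ≤ coneConst β * x ^ (-β) := by nlinarith
    nlinarith

theorem Tame.cone_opR {β : ℝ} (hβ0 : 0 < β) (hβ1 : β < 1) {f : ℝ → ℝ} (hf : Tame f) :
    Cone β (PomeauManneville.opR f) :=
  cone_of_le hβ0 hβ1 hf.opR fun _ hx => hf.opR_le hx

theorem cone_one {β : ℝ} (hβ0 : 0 < β) (hβ1 : β < 1) : Cone β fun _ => 1 :=
  cone_of_le hβ0 hβ1 tame_one fun _ _ => by norm_num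

/-- The transfer operator of `mapReal a` with respect to Lebesgue measure. -/
noncomputable def tr (a : ℝ) (f : ℝ → ℝ) (x : ℝ) : ℝ := opL a f x + opR f x

theorem Tame.tr {a : ℝ} (ha : 0 < a) (ha1 : a ≤ 1) {f : ℝ → ℝ} (hf : Tame f) : Tame (tr a f) :=
  (hf.opL ha ha1).add hf.opR

theorem integrable_mul_bdd {μ : Measure ℝ} {f ψ : ℝ → ℝ} (hf : Integrable f μ)
    (hψ : Measurable ψ) {B : ℝ} (hB : ∀ x, |ψ x| ≤ B) : Integrable (fun x => f x * ψ x) μ :=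
  hf.mul_bdd hψ.aestronglyMeasurable (Filter.Eventually.of_forall hB)

theorem integral_tr {a : ℝ} (ha : 0 < a) {f ψ : ℝ → ℝ} (hf : Integrable f unitVol)
    (hψ : Measurable ψ) {B : ℝ} (hB : ∀ x, |ψ x| ≤ B) :
    ∫ x, tr a f x * ψ x ∂unitVol = ∫ x, f x * ψ (mapReal a x) ∂unitVol := by
  simp only [tr, add_mul]
  rw [integral_add (integrable_mul_bdd (integrable_opL ha hf) hψ hB)
    (integrable_mul_bdd (integrable_opR hf) hψ hB), integral_opL ha, integral_opR a,
    ← compl_Iio]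
  exact integral_add_compl measurableSet_Iio
    (integrable_mul_bdd hf (hψ.comp (measurable_mapReal a)) fun x => hB _)

theorem integral_tr_one {a : ℝ} (ha : 0 < a) {f : ℝ → ℝ} (hf : Integrable f unitVol) :
    ∫ x, tr a f x ∂unitVol = ∫ x, f x ∂unitVol := by
  simpa using integral_tr ha hf (measurable_const (a := (1 : ℝ))) (B := 1) (by simp)

/-- A decreasing density is at most `2 ∫ f` on `[1/2, 1]`. -/
theorem Tame.le_two_mul {f : ℝ → ℝ} (hf : Tame f) {z : ℝ} (hz : z ∈ Icc (1 / 2 : ℝ) 1) :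
    f z ≤ 2 * ∫ x, f x ∂unitVol := by
  have hz' : z ∈ Ioc (0 : ℝ) 1 := ⟨by linarith [hz.1], hz.2⟩
  have h1 : ∫ _ in Iio (1 / 2 : ℝ), f z ∂unitVol ≤ ∫ x in Iio (1 / 2 : ℝ), f x ∂unitVol := by
    apply setIntegral_mono_ae_restrict (integrable_const _) hf.integrable.integrableOn
    filter_upwards [ae_restrict_mem measurableSet_Iio, ae_restrict_of_ae ae_unitVol_mem]
      with x hx hx'
    exact hf.anti hx' hz' (le_trans (le_of_lt hx) hz.1)
  have h2 : ∫ x in Iio (1 / 2 : ℝ), f x ∂unitVol ≤ ∫ x, f x ∂unitVol :=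
    setIntegral_le_integral hf.integrable (ae_unitVol_mem.mono fun x hx => hf.nonneg x hx)
  rw [unitVol_restrict_Iio] at h1
  simp at h1
  rw [unitVol_restrict_Iio] at h2
  simp at h2
  linarith

/-- Invariance of the cone. The left branch lowers the factor of `x ^ (-β)` by an amount of order
`x ^ β`, which pays for the contribution of the right branch. -/
theorem Cone.tr {a β : ℝ} (ha : 0 < a) (hab : a ≤ β) (hβ1 : β < 1) {f : ℝ → ℝ} (hf : Cone β f) :
    Cone β (tr a f) where
  toTame := hf.toTame.tr ha (by linarith)
  le_rpow x hx := by
    have hβ0 : 0 < β := ha.trans_le hab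
    rw [integral_tr_one ha hf.integrable]
    have h := leftInv_mem ha hx
    have hl := leftBranch_leftInv ha hx
    have hb := hf.le_rpow _ ⟨h.1, h.2.trans (by norm_num)⟩
    have hz := hf.toTame.le_two_mul (z := (x + 1) / 2) ⟨by linarith [hx.1], by linarith [hx.2]⟩
    have hm := hf.integral_nonneg
    unfold PomeauManneville.tr PomeauManneville.opL PomeauManneville.opR
    set m := ∫ y, f y ∂unitVol
    generalize leftInv a x = y at *
    set u := (2 * y) ^ a with hu
    have hy := h.1
    have hu0 : 0 < u := by positivity
    have hu1 : u ≤ 1 := Real.rpow_le_one (by positivity) (by linarith [h.2]) ha.le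
    have hxy : x = y * (1 + u) := hl.symm
    have hyx : y ^ (-β) = x ^ (-β) * (1 + u) ^ β := by
      rw [hxy, Real.mul_rpow hy.le (by positivity), mul_assoc, ← Real.rpow_add (by positivity)]
      simp
    have hber : (1 + u) ^ β ≤ 1 + β * u :=
      rpow_one_add_le_one_add_mul_self (by linarith) hβ0.le hβ1.le
    have hux : x ^ β ≤ u := by
      calc x ^ β ≤ (2 * y) ^ β := by
            apply Real.rpow_le_rpow hx.1.le _ hβ0.le
            rw [hxy]; nlinarith
        _ ≤ u := Real.rpow_le_rpow_of_exponent_ge (by positivity) (by linarith [h.2]) hab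
    have hxx : x ^ (-β) * x ^ β = 1 := by
      rw [← Real.rpow_add hx.1]; simp
    have hX : 0 < x ^ (-β) := Real.rpow_pos_of_pos hx.1 _
    have hA : 0 < coneConst β := by linarith [coneConst_ge hβ1]
    have hA' : 3 ≤ coneConst β * (1 - β) := by
      have : 0 < 1 - β := by linarith
      unfold coneConst
      rw [add_mul, div_mul_cancel₀ _ this.ne']
      nlinarith
    have hD : 0 < 1 + (a + 1) * u := by positivity
    have key : coneConst β * y ^ (-β) + (1 + (a + 1) * u) ≤
        coneConst β * x ^ (-β) * (1 + (a + 1) * u) := by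
      have h1 : coneConst β * y ^ (-β) ≤ coneConst β * x ^ (-β) * (1 + β * u) := by
        rw [hyx]
        have := mul_le_mul_of_nonneg_left hber (mul_pos hA hX).le
        linarith
      have h2 : 1 ≤ x ^ (-β) * u := by
        rw [← hxx]
        exact mul_le_mul_of_nonneg_left hux hX.le
      have h3 : 3 ≤ (coneConst β * (1 - β)) * (x ^ (-β) * u) := by nlinarith
      have h4 : (a + 1) * u ≤ 2 := by nlinarith
      have h5 : 0 ≤ coneConst β * x ^ (-β) * (a * u) := by positivity
      nlinarith
    have h1 : f y / (1 + (a + 1) * u) ≤ coneConst β * y ^ (-β) * m / (1 + (a + 1) * u) :=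
      div_le_div_of_nonneg_right hb hD.le
    have h2 : coneConst β * y ^ (-β) * m / (1 + (a + 1) * u) ≤ (coneConst β * x ^ (-β) - 1) * m := by
      rw [div_le_iff₀ hD]
      have := mul_le_mul_of_nonneg_right key hm
      nlinarith
    linarith

/-! ### Orbits, itineraries and inverse branches -/

/-- The composition `T_{α n} ∘ ⋯ ∘ T_{α 1}` on the real line. -/
noncomputable def orbit (α : ℕ → ℝ) : ℕ → ℝ → ℝ
  | 0 => id
  | n + 1 => mapReal (α (n + 1)) ∘ orbit α n

/-- The parameters that are used, those with positive index, lie in `(0, β]`. -/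
def Adm (β : ℝ) (α : ℕ → ℝ) : Prop := ∀ m, 1 ≤ m → 0 < α m ∧ α m ≤ β

/-- The sequence of parameters seen from time `k` on. -/
def shift (α : ℕ → ℝ) (k : ℕ) : ℕ → ℝ := fun m => α (k + m)

theorem Adm.shift {β : ℝ} {α : ℕ → ℝ} (h : Adm β α) (k : ℕ) : Adm β (shift α k) :=
  fun m hm => h (k + m) (by omega)

theorem orbit_succ (α : ℕ → ℝ) (n : ℕ) (x : ℝ) :
    orbit α (n + 1) x = mapReal (α (n + 1)) (orbit α n x) := rfl

theorem orbit_add (α : ℕ → ℝ) (m n : ℕ) (x : ℝ) :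
    orbit α (m + n) x = orbit (shift α m) n (orbit α m x) := by
  induction n with
  | zero => rfl
  | succ n ih => rw [← add_assoc, orbit_succ, orbit_succ, ih]; rfl

theorem measurable_orbit (α : ℕ → ℝ) (n : ℕ) : Measurable (orbit α n) := by
  induction n with
  | zero => exact measurable_id
  | succ n ih => exact (measurable_mapReal _).comp ih

theorem orbit_mem {β : ℝ} {α : ℕ → ℝ} (h : Adm β α) (n : ℕ) {x : ℝ} (hx : x ∈ Icc (0 : ℝ) 1) :
    orbit α n x ∈ Icc (0 : ℝ) 1 := by
  induction n with
  | zero => exact hx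
  | succ n ih => exact mapReal_mem (h (n + 1) (by omega)).1 ih

theorem orbit_at_zero (α : ℕ → ℝ) (n : ℕ) : orbit α n 0 = 0 := by
  induction n with
  | zero => rfl
  | succ n ih => rw [orbit_succ, ih]; simp [mapReal]

/-- The domain of the left branch (`true`) or of the right branch (`false`). -/
def side (b : Bool) : Set ℝ := if b then Iio (1 / 2) else Ici (1 / 2)

theorem mem_side {b : Bool} {x : ℝ} : x ∈ side b ↔ (x < 1 / 2 ↔ b = true) := by
  cases b <;> simp [side]

theorem measurableSet_side (b : Bool) : MeasurableSet (side b) := by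
  cases b
  · exact measurableSet_Ici
  · exact measurableSet_Iio

/-- The points with itinerary `w` during the first `N` steps. -/
def cyl (α : ℕ → ℝ) (w : ℕ → Bool) (N : ℕ) : Set ℝ := {x | ∀ s < N, orbit α s x ∈ side (w s)}

theorem cyl_succ (α : ℕ → ℝ) (w : ℕ → Bool) (N : ℕ) :
    cyl α w (N + 1) = cyl α w N ∩ orbit α N ⁻¹' side (w N) := by
  ext x
  simp only [cyl, mem_ofPred_eq, mem_inter_iff, mem_preimage, Nat.lt_succ_iff_lt_or_eq]
  constructor
  · exact fun h => ⟨fun s hs => h s (Or.inl hs), h N (Or.inr rfl)⟩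
  · rintro ⟨h1, h2⟩ s (hs | rfl)
    exacts [h1 s hs, h2]

theorem measurableSet_cyl (α : ℕ → ℝ) (w : ℕ → Bool) (N : ℕ) : MeasurableSet (cyl α w N) := by
  induction N with
  | zero => simp [cyl]
  | succ N ih =>
    rw [cyl_succ]
    exact ih.inter (measurable_orbit α N (measurableSet_side _))

/-- The contribution of the inverse branch with itinerary `w` to the `N`-step transfer operator. -/
noncomputable def br (α : ℕ → ℝ) (w : ℕ → Bool) (f : ℝ → ℝ) : ℕ → ℝ → ℝ
  | 0 => f
  | N + 1 => if w N then opL (α (N + 1)) (br α w f N) else opR (br α w f N)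

theorem br_succ (α : ℕ → ℝ) (w : ℕ → Bool) (f : ℝ → ℝ) (N : ℕ) :
    br α w f (N + 1) = if w N then opL (α (N + 1)) (br α w f N) else opR (br α w f N) := rfl

theorem integral_br {β : ℝ} {α : ℕ → ℝ} (hα : Adm β α) (w : ℕ → Bool) (f : ℝ → ℝ) (N : ℕ)
    (ψ : ℝ → ℝ) : ∫ x, br α w f N x * ψ x ∂unitVol =
      ∫ x in cyl α w N, f x * ψ (orbit α N x) ∂unitVol := by
  induction N generalizing ψ with
  | zero => simp [br, cyl, orbit]
  | succ N ih =>
    have hs : ∫ x, br α w f (N + 1) x * ψ x ∂unitVol =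
        ∫ x in side (w N), br α w f N x * ψ (mapReal (α (N + 1)) x) ∂unitVol := by
      rw [br_succ]
      cases w N
      · exact integral_opR _ _ _
      · exact integral_opL (hα (N + 1) (by omega)).1 _ _
    rw [hs, cyl_succ, ← integral_indicator (measurableSet_side _)]
    have h1 := ih ((side (w N)).indicator fun x => ψ (mapReal (α (N + 1)) x))
    simp only [← indicator_mul_right] at h1
    rw [h1, ← setIntegral_indicator (measurable_orbit α N (measurableSet_side _))]
    congr 1
    ext x
    by_cases h : orbit α N x ∈ side (w N)
    · rw [indicator_of_mem h, indicator_of_mem (show x ∈ orbit α N ⁻¹' side (w N) from h)]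
      rfl
    · rw [indicator_of_notMem h, indicator_of_notMem (show x ∉ orbit α N ⁻¹' side (w N) from h)]
      simp

theorem integral_br_one {β : ℝ} {α : ℕ → ℝ} (hα : Adm β α) (w : ℕ → Bool) (f : ℝ → ℝ) (N : ℕ) :
    ∫ x, br α w f N x ∂unitVol = ∫ x in cyl α w N, f x ∂unitVol := by
  simpa using integral_br hα w f N fun _ => 1

theorem Tame.br {β : ℝ} (hβ1 : β < 1) {α : ℕ → ℝ} (hα : Adm β α) (w : ℕ → Bool) {f : ℝ → ℝ}
    (hf : Tame f) (N : ℕ) : Tame (br α w f N) := by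
  induction N with
  | zero => exact hf
  | succ N ih =>
    unfold PomeauManneville.br
    have := hα (N + 1) (by omega)
    split_ifs
    · exact ih.opL this.1 (by linarith)
    · exact ih.opR

/-- The transfer operator of `orbit α N`. -/
noncomputable def trN (α : ℕ → ℝ) (f : ℝ → ℝ) : ℕ → ℝ → ℝ
  | 0 => f
  | N + 1 => tr (α (N + 1)) (trN α f N)

theorem Cone.trN {β : ℝ} (hβ1 : β < 1) {α : ℕ → ℝ} (hα : Adm β α) {f : ℝ → ℝ} (hf : Cone β f)
    (N : ℕ) : Cone β (trN α f N) := by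
  induction N with
  | zero => exact hf
  | succ N ih => exact ih.tr (hα (N + 1) (by omega)).1 (hα (N + 1) (by omega)).2 hβ1

theorem integral_trN {β : ℝ} (hβ1 : β < 1) {α : ℕ → ℝ} (hα : Adm β α) {f : ℝ → ℝ}
    (hf : Cone β f) (N : ℕ) {ψ : ℝ → ℝ} (hψ : Measurable ψ) {B : ℝ} (hB : ∀ x, |ψ x| ≤ B) :
    ∫ x, trN α f N x * ψ x ∂unitVol = ∫ x, f x * ψ (orbit α N x) ∂unitVol := by
  induction N generalizing ψ with
  | zero => rfl
  | succ N ih =>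
    have h := hα (N + 1) (by omega)
    exact (integral_tr h.1 (hf.trN hβ1 hα N).integrable hψ hB).trans
      (ih (hψ.comp (measurable_mapReal _)) fun x => hB _)

theorem integral_trN_one {β : ℝ} (hβ1 : β < 1) {α : ℕ → ℝ} (hα : Adm β α) {f : ℝ → ℝ}
    (hf : Cone β f) (N : ℕ) : ∫ x, trN α f N x ∂unitVol = ∫ x, f x ∂unitVol := by
  simpa using integral_trN hβ1 hα hf N (measurable_const (a := (1 : ℝ))) (B := 1) (by simp)

/-! ### Diameters of cylinders -/

/-- One step expands the distance of two points of the same branch. -/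
theorem expand {a β x y : ℝ} (ha : 0 < a) (hab : a ≤ β) (hx : x ∈ Icc (0 : ℝ) 1)
    (hy : y ∈ Icc (0 : ℝ) 1) (hxy : x < 1 / 2 ↔ y < 1 / 2) :
    |x - y| ≤ 1 / 2 ∧ |x - y| * (1 + (2 * |x - y|) ^ β) ≤ |mapReal a x - mapReal a y| := by
  wlog h : y ≤ x generalizing x y
  · have := this hy hx hxy.symm (le_of_not_ge h)
    rwa [abs_sub_comm, abs_sub_comm (mapReal a x)]
  have hd : 0 ≤ x - y := sub_nonneg.2 h
  rw [abs_of_nonneg hd]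
  have hle : x - y ≤ 1 / 2 := by
    rcases lt_or_ge x (1 / 2) with h1 | h1
    · linarith [hy.1]
    · have : 1 / 2 ≤ y := not_lt.1 fun h2 => absurd (hxy.2 h2) (not_lt.2 h1)
      linarith [hx.2]
  refine ⟨hle, le_trans ?_ (le_abs_self _)⟩
  have hβ : (2 * (x - y)) ^ β ≤ (2 * (x - y)) ^ a := by
    rcases hd.eq_or_lt with h0 | h0
    · rw [← h0, mul_zero, Real.zero_rpow ha.ne', Real.zero_rpow (by linarith)]
    · exact Real.rpow_le_rpow_of_exponent_ge (by positivity) (by linarith) hab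
  rcases lt_or_ge x (1 / 2) with h1 | h1
  · rw [mapReal_of_lt hx.1 h1, mapReal_of_lt hy.1 (hxy.1 h1)]
    refine le_trans ?_ (leftBranch_sub ha hy.1 h)
    unfold leftBranch
    exact mul_le_mul_of_nonneg_left (by linarith) hd
  · have h2 : 1 / 2 ≤ y := not_lt.1 fun h2 => absurd (hxy.2 h2) (not_lt.2 h1)
    rw [mapReal_of_ge h1, mapReal_of_ge h2]
    have : (2 * (x - y)) ^ β ≤ 1 := Real.rpow_le_one (by positivity) (by linarith) (by linarith)
    nlinarith

/-- The bound for the length of the cylinders of `N` steps. -/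
noncomputable def diamBound (β : ℝ) (N : ℕ) : ℝ := (2 / (β * N)) ^ (1 / β)

/-- Each step back adds at least `β / 2` to `d ^ (-β)`. -/
theorem le_diamBound {β : ℝ} (hβ0 : 0 < β) (hβ1 : β < 1) {d : ℕ → ℝ} {N : ℕ} (hN : 1 ≤ N)
    (h0 : ∀ s, 0 ≤ d s)
    (h : ∀ s < N, d s ≤ 1 / 2 ∧ d s * (1 + (2 * d s) ^ β) ≤ d (s + 1)) :
    d 0 ≤ diamBound β N := by
  unfold diamBound
  rcases (h0 0).eq_or_lt with hz | hz
  · rw [← hz]; positivity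
  have hpos : ∀ s ≤ N, 0 < d s := by
    intro s
    induction s with
    | zero => exact fun _ => hz
    | succ s ih =>
      intro hs
      have := ih (by omega)
      exact lt_of_lt_of_le (by positivity) (h s (by omega)).2
  have hstep : ∀ s < N, d (s + 1) ^ (-β) + β / 2 ≤ d s ^ (-β) := by
    intro s hs
    have hp := hpos s hs.le
    obtain ⟨h1, h2⟩ := h s hs
    set u := (2 * d s) ^ β with hu
    have hu0 : 0 < u := by positivity
    have hu1 : u ≤ 1 := Real.rpow_le_one (by positivity) (by linarith) hβ0.le
    have e1 : d (s + 1) ^ (-β) ≤ (d s * (1 + u)) ^ (-β) :=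
      Real.rpow_le_rpow_of_nonpos (by positivity) h2 (by linarith)
    have e2 : (d s * (1 + u)) ^ (-β) = d s ^ (-β) * (1 + -(u / (1 + u))) ^ β := by
      rw [Real.mul_rpow hp.le (by positivity), Real.rpow_neg (by positivity : 0 ≤ 1 + u),
        ← Real.inv_rpow (by positivity)]
      congr 2
      field_simp
      ring
    have hq : u / 2 ≤ u / (1 + u) := by
      apply div_le_div_of_nonneg_left hu0.le <;> linarith
    have hq1 : u / (1 + u) ≤ 1 := (div_le_one (by positivity)).2 (by linarith)
    have e3 : (1 + -(u / (1 + u))) ^ β ≤ 1 + β * -(u / (1 + u)) :=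
      rpow_one_add_le_one_add_mul_self (by linarith) hβ0.le hβ1.le
    have e4 : 1 ≤ d s ^ (-β) * u := by
      rw [hu, Real.mul_rpow (by norm_num) hp.le, mul_left_comm, ← Real.rpow_add hp]
      simp only [neg_add_cancel, Real.rpow_zero, mul_one]
      exact Real.one_le_rpow (by norm_num) hβ0.le
    have hD : 0 < d s ^ (-β) := Real.rpow_pos_of_pos hp _
    have e5 : d s ^ (-β) * (1 + -(u / (1 + u))) ^ β ≤ d s ^ (-β) * (1 - β * (u / 2)) := by
      apply mul_le_mul_of_nonneg_left _ hD.le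
      nlinarith
    have e6 : β / 2 ≤ (d s ^ (-β) * u) * (β / 2) := by nlinarith
    nlinarith
  have hsum : ∀ s ≤ N, s * (β / 2) + d s ^ (-β) ≤ d 0 ^ (-β) := by
    intro s
    induction s with
    | zero => simp
    | succ s ih =>
      intro hs
      have h1 := ih (by omega)
      have h2 := hstep s (by omega)
      push_cast
      linarith
  have hfin := hsum N le_rfl
  have hN0 : (0 : ℝ) < N := by exact_mod_cast hN
  have h1 : N * (β / 2) ≤ d 0 ^ (-β) := by
    have : 0 < d N ^ (-β) := Real.rpow_pos_of_pos (hpos N le_rfl) _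
    linarith
  have h2 : d 0 ^ β ≤ 2 / (β * N) := by
    rw [Real.rpow_neg hz.le] at h1
    have h3 := inv_anti₀ (by positivity) h1
    rw [inv_inv] at h3
    refine h3.trans (le_of_eq ?_)
    field_simp
  calc d 0 = (d 0 ^ β) ^ (1 / β) := by
        rw [← Real.rpow_mul hz.le, mul_one_div_cancel hβ0.ne', Real.rpow_one]
    _ ≤ _ := Real.rpow_le_rpow (by positivity) h2 (by positivity)

theorem dist_le_diamBound {β : ℝ} (hβ0 : 0 < β) (hβ1 : β < 1) {α : ℕ → ℝ} (hα : Adm β α)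
    {N : ℕ} (hN : 1 ≤ N) {x y : ℝ} (hx : x ∈ Icc (0 : ℝ) 1) (hy : y ∈ Icc (0 : ℝ) 1)
    (h : ∀ s < N, (orbit α s x < 1 / 2 ↔ orbit α s y < 1 / 2)) :
    |x - y| ≤ diamBound β N := by
  apply le_diamBound (d := fun s => |orbit α s x - orbit α s y|) hβ0 hβ1 hN
    (fun s => abs_nonneg _)
  intro s hs
  have := hα (s + 1) (by omega)
  exact expand this.1 this.2 (orbit_mem hα s hx) (orbit_mem hα s hy) (h s hs)

theorem cyl_dist_le {β : ℝ} (hβ0 : 0 < β) (hβ1 : β < 1) {α : ℕ → ℝ} (hα : Adm β α)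
    {w : ℕ → Bool} {N s : ℕ} (hs : s < N) {x y : ℝ} (hx : x ∈ Icc (0 : ℝ) 1)
    (hy : y ∈ Icc (0 : ℝ) 1) (hxw : x ∈ cyl α w N) (hyw : y ∈ cyl α w N) :
    |orbit α s x - orbit α s y| ≤ diamBound β (N - s) := by
  apply dist_le_diamBound hβ0 hβ1 (hα.shift s) (by omega) (orbit_mem hα s hx) (orbit_mem hα s hy)
  intro r hr
  rw [← orbit_add, ← orbit_add]
  have h1 := mem_side.1 (hxw (s + r) (by omega))
  have h2 := mem_side.1 (hyw (s + r) (by omega))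
  exact h1.trans h2.symm

/-- Points that stay in the left half for `N` steps are close to the fixed point `0`. -/
theorem le_diamBound_of_left {β : ℝ} (hβ0 : 0 < β) (hβ1 : β < 1) {α : ℕ → ℝ} (hα : Adm β α)
    {N : ℕ} (hN : 1 ≤ N) {x : ℝ} (hx : x ∈ Icc (0 : ℝ) 1)
    (h : ∀ s < N, orbit α s x < 1 / 2) : x ≤ diamBound β N := by
  have := dist_le_diamBound hβ0 hβ1 hα hN hx (y := 0) (by simp)
    (fun s hs => by rw [orbit_at_zero]; exact ⟨fun _ => by norm_num, fun _ => h s hs⟩)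
  rw [sub_zero, abs_of_nonneg hx.1] at this
  exact this

/-! ### Mass estimates in the cone -/

theorem unitVol_restrict_Iic {δ : ℝ} (hδ1 : δ ≤ 1) :
    unitVol.restrict (Iic δ) = volume.restrict (Ioc 0 δ) := by
  rw [unitVol, Measure.restrict_restrict measurableSet_Iic]
  congr 1
  ext x
  simp only [mem_inter_iff, mem_Iic, mem_Ioc]
  constructor
  · rintro ⟨h, h', -⟩; exact ⟨h', h⟩
  · rintro ⟨h, h'⟩; exact ⟨h', h, h'.trans hδ1⟩

theorem integrable_rpow_neg {β : ℝ} (hβ1 : β < 1) :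
    Integrable (fun x : ℝ => x ^ (-β)) unitVol := by
  have h := intervalIntegral.intervalIntegrable_rpow' (a := 0) (b := 1) (r := -β) (by linarith)
  rw [intervalIntegrable_iff_integrableOn_Ioc_of_le zero_le_one] at h
  exact h

theorem setIntegral_rpow_neg {β δ : ℝ} (hβ1 : β < 1) (hδ0 : 0 ≤ δ) (hδ1 : δ ≤ 1) :
    ∫ x in Iic δ, x ^ (-β) ∂unitVol = δ ^ (1 - β) / (1 - β) := by
  rw [unitVol_restrict_Iic hδ1, ← intervalIntegral.integral_of_le hδ0,
    integral_rpow (Or.inl (by linarith)), Real.zero_rpow (by linarith)]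
  rw [sub_zero, neg_add_eq_sub]

theorem Cone.setIntegral_Iic_le {β δ : ℝ} (hβ1 : β < 1) {f : ℝ → ℝ} (hf : Cone β f)
    (hδ0 : 0 ≤ δ) (hδ1 : δ ≤ 1) : ∫ x in Iic δ, f x ∂unitVol ≤
      coneConst β / (1 - β) * δ ^ (1 - β) * ∫ x, f x ∂unitVol := by
  have h : ∫ x in Iic δ, f x ∂unitVol ≤
      ∫ x in Iic δ, coneConst β * (∫ x, f x ∂unitVol) * x ^ (-β) ∂unitVol := by
    apply setIntegral_mono_ae_restrict hf.integrable.integrableOn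
    · exact ((integrable_rpow_neg hβ1).const_mul _).integrableOn
    · filter_upwards [ae_restrict_of_ae ae_unitVol_mem] with x hx
      have := hf.le_rpow x hx
      linarith
  rw [integral_const_mul, setIntegral_rpow_neg hβ1 hδ0 hδ1] at h
  refine h.trans (le_of_eq ?_)
  ring

/-- Densities in the cone are bounded below by a fixed proportion of their mass. -/
theorem exists_cone_lower_bound {β : ℝ} (hβ1 : β < 1) :
    ∃ κ : ℝ, 0 < κ ∧ κ ≤ 1 ∧ ∀ f, Cone β f → ∀ x ∈ Ioc (0 : ℝ) 1, κ * ∫ y, f y ∂unitVol ≤ f x := by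
  have hb : 0 < 1 - β := by linarith
  have hA := coneConst_ge hβ1
  -- `δ` is chosen such that at least half of the mass lies to the right of `δ`
  set r := (1 - β) / (2 * coneConst β) with hr
  have hr0 : 0 < r := by positivity
  obtain ⟨δ, hδ0, hδ1, hδr⟩ : ∃ δ : ℝ, 0 < δ ∧ δ ≤ 1 ∧ δ ^ (1 - β) ≤ r := by
    refine ⟨min 1 (r ^ (1 / (1 - β))), by positivity, min_le_left _ _, ?_⟩
    calc (min 1 (r ^ (1 / (1 - β)))) ^ (1 - β) ≤ (r ^ (1 / (1 - β))) ^ (1 - β) :=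
          Real.rpow_le_rpow (by positivity) (min_le_right _ _) hb.le
      _ = r := by
          rw [← Real.rpow_mul hr0.le, one_div_mul_cancel hb.ne', Real.rpow_one]
  refine ⟨δ ^ 2 / 2, by positivity, by nlinarith, fun f hf x hx => ?_⟩
  have hδm : δ ∈ Ioc (0 : ℝ) 1 := ⟨hδ0, hδ1⟩
  have hm := hf.integral_nonneg
  have h1 := hf.setIntegral_Iic_le hβ1 hδ0.le hδ1
  have h1' : ∫ x in Iic δ, f x ∂unitVol ≤ 1 / 2 * ∫ x, f x ∂unitVol := by
    refine h1.trans (mul_le_mul_of_nonneg_right ?_ hm)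
    calc coneConst β / (1 - β) * δ ^ (1 - β) ≤ coneConst β / (1 - β) * r := by gcongr
      _ = 1 / 2 := by
        rw [hr]; field_simp
  have h2 : ∫ x in Ioi δ, f x ∂unitVol ≤ f δ := by
    have h3 : ∫ x in Ioi δ, f x ∂unitVol ≤ ∫ x in Ioi δ, f δ ∂unitVol := by
      apply setIntegral_mono_ae_restrict hf.integrable.integrableOn
        (integrable_const _)
      filter_upwards [ae_restrict_of_ae ae_unitVol_mem, ae_restrict_mem measurableSet_Ioi]
        with x hx hx'
      exact hf.anti hδm hx (le_of_lt hx')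
    refine h3.trans ?_
    rw [setIntegral_const, smul_eq_mul]
    have := hf.nonneg δ hδm
    have h4 : unitVol.real (Ioi δ) ≤ 1 := measureReal_le_one
    nlinarith
  have h3 : ∫ x in Iic δ, f x ∂unitVol + ∫ x in Ioi δ, f x ∂unitVol = ∫ x, f x ∂unitVol := by
    rw [← compl_Iic]
    exact integral_add_compl measurableSet_Iic hf.integrable
  have h4 := hf.mono hδm one_mem_Ioc hδ1
  simp only [one_pow, one_mul] at h4
  have h5 := hf.anti hx one_mem_Ioc hx.2
  have h6 : δ ^ 2 * (1 / 2 * ∫ x, f x ∂unitVol) ≤ δ ^ 2 * f δ :=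
    mul_le_mul_of_nonneg_left (by linarith) (by positivity)
  linarith

/-! ### The partition into cells that end with the right branch -/

/-- The itinerary `w` during `Q` steps, then `j` times the left branch, then the right branch. -/
def word (Q : ℕ) (w : Fin Q → Bool) (j : ℕ) (s : ℕ) : Bool :=
  if h : s < Q then w ⟨s, h⟩ else decide (s < Q + j)

/-- The cell of all points that have the itinerary `w` during `Q` steps and take the right branch
for the first time after `j` further steps. -/
def cell (α : ℕ → ℝ) (Q : ℕ) (i : (Fin Q → Bool) × ℕ) : Set ℝ :=
  cyl α (word Q i.1 i.2) (Q + i.2 + 1)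

/-- The points that do not take the right branch at the times `Q, …, Q + m - 1`. -/
def tail (α : ℕ → ℝ) (Q m : ℕ) : Set ℝ := {x | ∀ s < m, orbit α (Q + s) x < 1 / 2}

theorem measurableSet_tail (α : ℕ → ℝ) (Q m : ℕ) : MeasurableSet (tail α Q m) := by
  have : tail α Q m = ⋂ s, ⋂ (_ : s < m), orbit α (Q + s) ⁻¹' Iio (1 / 2) := by
    ext x; simp [tail]
  rw [this]
  exact MeasurableSet.iInter fun s => MeasurableSet.iInter fun _ =>
    measurable_orbit α _ measurableSet_Iio

theorem mem_cell {α : ℕ → ℝ} {Q : ℕ} {i : (Fin Q → Bool) × ℕ} {x : ℝ} :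
    x ∈ cell α Q i ↔ (∀ s : Fin Q, (orbit α s x < 1 / 2 ↔ i.1 s = true)) ∧
      (∀ s < i.2, orbit α (Q + s) x < 1 / 2) ∧ ¬ orbit α (Q + i.2) x < 1 / 2 := by
  unfold cell cyl
  simp only [mem_ofPred_eq, mem_side]
  constructor
  · intro h
    refine ⟨fun s => ?_, fun s hs => ?_, ?_⟩
    · have := h s (by omega)
      simpa [word] using this
    · have := h (Q + s) (by omega)
      simpa [word, hs] using this
    · have := h (Q + i.2) (by omega)
      simpa [word] using this
  · rintro ⟨h1, h2, h3⟩ s hs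
    by_cases h : s < Q
    · have := h1 ⟨s, h⟩
      simpa [word, h] using this
    · obtain ⟨r, rfl⟩ := Nat.exists_eq_add_of_le (not_lt.1 h)
      by_cases hr : r < i.2
      · have := h2 r hr
        simpa [word, hr] using this
      · obtain rfl : r = i.2 := by omega
        simpa [word] using h3

theorem iUnion_cell (α : ℕ → ℝ) (Q m : ℕ) :
    ⋃ i : (Fin Q → Bool) × Fin m, cell α Q (i.1, i.2) = (tail α Q m)ᶜ := by
  ext x
  simp only [mem_iUnion, mem_cell, mem_compl_iff]
  constructor
  · rintro ⟨⟨w, j⟩, -, -, h⟩ ht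
    exact h (ht j j.2)
  · intro h
    have h' : ∃ s, s < m ∧ ¬ orbit α (Q + s) x < 1 / 2 := by
      by_contra hc
      push Not at hc
      exact h hc
    classical
    have hs := Nat.find_spec h'
    refine ⟨(fun s => decide (orbit α s x < 1 / 2), ⟨Nat.find h', hs.1⟩), fun s => by simp,
      fun s hs' => ?_, hs.2⟩
    by_contra hc
    simp only at hs'
    exact Nat.find_min h' hs' ⟨lt_trans hs' hs.1, hc⟩

theorem pairwise_disjoint_cell (α : ℕ → ℝ) (Q m : ℕ) :
    Pairwise (Function.onFun Disjoint
      fun i : (Fin Q → Bool) × Fin m => cell α Q (i.1, i.2)) := by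
  rintro ⟨w, j⟩ ⟨w', j'⟩ hne
  refine Set.disjoint_left.2 fun x hx hx' => hne ?_
  rw [mem_cell] at hx hx'
  simp only at hx hx'
  have h1 : w = w' := by
    funext s
    have := (hx.1 s).symm.trans (hx'.1 s)
    exact Bool.eq_iff_iff.2 this
  have h2 : j = j' := by
    rcases lt_trichotomy (j : ℕ) j' with h | h | h
    · exact absurd (hx'.2.1 _ h) hx.2.2
    · exact Fin.ext h
    · exact absurd (hx.2.1 _ h) hx'.2.2
  rw [h1, h2]

theorem measurableSet_cell (α : ℕ → ℝ) (Q : ℕ) (i : (Fin Q → Bool) × ℕ) :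
    MeasurableSet (cell α Q i) := measurableSet_cyl _ _ _

theorem integral_eq_sum_cell (α : ℕ → ℝ) (Q m : ℕ) {g : ℝ → ℝ} (hg : Integrable g unitVol) :
    ∫ x, g x ∂unitVol =
      ∑ i : (Fin Q → Bool) × Fin m, ∫ x in cell α Q (i.1, i.2), g x ∂unitVol +
        ∫ x in tail α Q m, g x ∂unitVol := by
  rw [← integral_iUnion_fintype (fun i => measurableSet_cell α Q _) (pairwise_disjoint_cell α Q m)
    (fun i => hg.integrableOn), iUnion_cell, add_comm]
  exact (integral_add_compl (measurableSet_tail α Q m) hg).symm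

theorem sum_cell_le (α : ℕ → ℝ) (Q m : ℕ) {g : ℝ → ℝ} (hg : Integrable g unitVol)
    (h0 : ∀ x ∈ Ioc (0 : ℝ) 1, 0 ≤ g x) :
    ∑ i : (Fin Q → Bool) × Fin m, ∫ x in cell α Q (i.1, i.2), g x ∂unitVol ≤
      ∫ x, g x ∂unitVol := by
  rw [integral_eq_sum_cell α Q m hg]
  have : 0 ≤ ∫ x in tail α Q m, g x ∂unitVol :=
    integral_nonneg_of_ae (ae_restrict_of_ae (ae_unitVol_mem.mono fun x hx => h0 x hx))
  linarith

/-- The density transported along a cell is the output of a right branch. -/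
theorem br_cell_eq (α : ℕ → ℝ) (Q : ℕ) (i : (Fin Q → Bool) × ℕ) (f : ℝ → ℝ) :
    br α (word Q i.1 i.2) f (Q + i.2 + 1) = opR (br α (word Q i.1 i.2) f (Q + i.2)) := by
  rw [br_succ, if_neg]
  simp [word]

theorem cone_br_cell {β : ℝ} (hβ0 : 0 < β) (hβ1 : β < 1) {α : ℕ → ℝ} (hα : Adm β α) (Q : ℕ)
    (i : (Fin Q → Bool) × ℕ) {f : ℝ → ℝ} (hf : Tame f) :
    Cone β (br α (word Q i.1 i.2) f (Q + i.2 + 1)) := by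
  rw [br_cell_eq]
  exact (hf.br hβ1 hα _ _).cone_opR hβ0 hβ1

/-- Points of one cell stay close to each other up to time `Q`. -/
theorem cell_dist_le {β : ℝ} (hβ0 : 0 < β) (hβ1 : β < 1) {α : ℕ → ℝ} (hα : Adm β α)
    {Q s : ℕ} (hs : s < Q) (i : (Fin Q → Bool) × ℕ) {x y : ℝ} (hx : x ∈ Icc (0 : ℝ) 1)
    (hy : y ∈ Icc (0 : ℝ) 1) (hxi : x ∈ cell α Q i) (hyi : y ∈ cell α Q i) :
    |orbit α s x - orbit α s y| ≤ diamBound β (Q - s) := by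
  apply cyl_dist_le hβ0 hβ1 hα hs hx hy (w := word Q i.1 i.2)
  · exact fun r hr => hxi r (by omega)
  · exact fun r hr => hyi r (by omega)

/-- The set of points without a right branch in a window of length `m` has small mass. -/
theorem Cone.setIntegral_tail_le {β : ℝ} (hβ0 : 0 < β) (hβ1 : β < 1) {α : ℕ → ℝ} (hα : Adm β α)
    {f : ℝ → ℝ} (hf : Cone β f) (Q : ℕ) {m : ℕ} (hm : 1 ≤ m) :
    ∫ x in tail α Q m, f x ∂unitVol ≤
      coneConst β / (1 - β) * (min 1 (diamBound β m)) ^ (1 - β) * ∫ x, f x ∂unitVol := by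
  set Z := tail (shift α Q) 0 m with hZ
  have hZm : MeasurableSet Z := measurableSet_tail _ _ _
  have hd : 0 ≤ diamBound β m := by unfold diamBound; positivity
  have h1 : ∫ x in tail α Q m, f x ∂unitVol = ∫ x in Z, PomeauManneville.trN α f Q x ∂unitVol := by
    have h := integral_trN hβ1 hα hf Q (ψ := Z.indicator fun _ => 1)
      (measurable_const.indicator hZm) (B := 1) (fun x => by
        by_cases hx : x ∈ Z <;> simp [hx])
    rw [← integral_indicator hZm, ← integral_indicator (measurableSet_tail α Q m)]
    have hmem : ∀ x, orbit α Q x ∈ Z ↔ x ∈ tail α Q m := by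
      intro x
      simp [hZ, tail, orbit_add]
    convert h.symm using 2
    · ext x
      by_cases hx : x ∈ tail α Q m
      · simp [hx, (hmem x).2 hx]
      · simp [hx, (hmem x).not.2 hx]
    · ext x
      by_cases hx : x ∈ Z <;> simp [hx]
  have hT := hf.trN hβ1 hα Q
  have h2 : ∫ x in Z, PomeauManneville.trN α f Q x ∂unitVol ≤
      ∫ x in Iic (min 1 (diamBound β m)), PomeauManneville.trN α f Q x ∂unitVol := by
    apply setIntegral_mono_set hT.integrable.integrableOn
    · exact ae_restrict_of_ae (ae_unitVol_mem.mono fun x hx => hT.nonneg x hx)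
    · filter_upwards [ae_unitVol_mem] with x hx hxZ
      refine le_min hx.2 (le_diamBound_of_left hβ0 hβ1 (hα.shift Q) hm ⟨hx.1.le, hx.2⟩ ?_)
      intro s hs
      have := hxZ s hs
      rwa [zero_add] at this
  rw [h1, ← integral_trN_one hβ1 hα hf Q]
  exact h2.trans (hT.setIntegral_Iic_le hβ1 (le_min zero_le_one hd) (min_le_left _ _))

/-- A cell spreads over the unit interval: at any later time its image carries a fixed proportion
of Lebesgue measure. -/
theorem exists_cell_minorization {β : ℝ} (hβ0 : 0 < β) (hβ1 : β < 1) :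
    ∃ κ : ℝ, 0 < κ ∧ κ ≤ 1 ∧ ∀ α, Adm β α → ∀ (Q : ℕ) (i : (Fin Q → Bool) × ℕ) (b : ℕ),
      Q + i.2 + 1 ≤ b → ∀ (ψ : ℝ → ℝ) (B : ℝ), Measurable ψ → (∀ x, 0 ≤ ψ x) → (∀ x, ψ x ≤ B) →
      κ * unitVol.real (cell α Q i) * ∫ x, ψ x ∂unitVol ≤
        ∫ x in cell α Q i, ψ (orbit α b x) ∂unitVol := by
  obtain ⟨κ, hκ0, hκ1, hκ⟩ := exists_cone_lower_bound hβ1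
  refine ⟨κ / 4, by positivity, by linarith, fun α hα Q i b hb ψ B hψ h0 hB => ?_⟩
  have habs : ∀ x, |ψ x| ≤ B := fun x => by rw [abs_of_nonneg (h0 x)]; exact hB x
  obtain ⟨n, rfl⟩ := Nat.exists_eq_add_of_le hb
  set N := Q + i.2 + 1
  set h := br α (word Q i.1 i.2) (fun _ => 1) N with hh
  have hmass : ∫ x, h x ∂unitVol = unitVol.real (cell α Q i) := by
    rw [hh, integral_br_one hα]
    simp [cell, N]
  have hlow : ∀ x ∈ Ioc (0 : ℝ) 1, unitVol.real (cell α Q i) / 4 ≤ h x := by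
    intro x hx
    have hT := tame_one.br hβ1 hα (word Q i.1 i.2) (Q + i.2)
    have h1 := hT.integral_opR_le
    have h2 := hT.opR.anti hx one_mem_Ioc hx.2
    rw [← hmass, hh, br_cell_eq]
    linarith
  have hψ' : Measurable fun x => ψ (orbit (shift α N) n x) := hψ.comp (measurable_orbit _ _)
  have e1 : ∫ x in cell α Q i, ψ (orbit α (N + n) x) ∂unitVol =
      ∫ x, h x * ψ (orbit (shift α N) n x) ∂unitVol := by
    rw [hh, integral_br hα _ _ _ fun x => ψ (orbit (shift α N) n x)]
    simp only [one_mul, orbit_add]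
    rfl
  have hT1 := (cone_one hβ0 hβ1).trN hβ1 (hα.shift N) n
  have e2 : κ * ∫ x, ψ x ∂unitVol ≤ ∫ x, ψ (orbit (shift α N) n x) ∂unitVol := by
    have := integral_trN hβ1 (hα.shift N) (cone_one hβ0 hβ1) n hψ habs
    simp only [one_mul] at this
    rw [← this, ← integral_const_mul]
    apply integral_mono_ae
    · have := integrable_mul_bdd (integrable_const κ) hψ habs (μ := unitVol)
      exact this
    · exact integrable_mul_bdd hT1.integrable hψ habs
    · filter_upwards [ae_unitVol_mem] with x hx
      have h1 := hκ _ hT1 x hx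
      rw [integral_trN_one hβ1 (hα.shift N) (cone_one hβ0 hβ1)] at h1
      simp at h1
      exact mul_le_mul_of_nonneg_right h1 (h0 x)
  have e3 : unitVol.real (cell α Q i) / 4 * ∫ x, ψ (orbit (shift α N) n x) ∂unitVol ≤
      ∫ x, h x * ψ (orbit (shift α N) n x) ∂unitVol := by
    rw [← integral_const_mul]
    apply integral_mono_ae
    · exact integrable_mul_bdd (integrable_const _) hψ' (fun x => habs _)
    · exact integrable_mul_bdd (tame_one.br hβ1 hα _ _).integrable hψ' (fun x => habs _)
    · filter_upwards [ae_unitVol_mem] with x hx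
      exact mul_le_mul_of_nonneg_right (hlow x hx) (h0 _)
  rw [e1]
  have hI : 0 ≤ unitVol.real (cell α Q i) := measureReal_nonneg
  have := mul_le_mul_of_nonneg_left e2 (div_nonneg hI (by norm_num : (0 : ℝ) ≤ 4))
  linarith

/-! ### Oscillation of cone densities on short intervals -/

/-- Up to constants, the oscillation at `x` of a cone density at scale `δ`. -/
noncomputable def oscBound (β δ x : ℝ) : ℝ := x ^ (-β) * min 1 (δ / x)

theorem Cone.osc_le {β : ℝ} (hβ0 : 0 < β) (hβ1 : β < 1) {f : ℝ → ℝ} (hf : Cone β f)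
    (hm : ∫ x, f x ∂unitVol = 1) {δ x y : ℝ} (hδ0 : 0 < δ) (hδ1 : δ ≤ 1)
    (hx : x ∈ Ioc (0 : ℝ) 1) (hy : y ∈ Ioc (0 : ℝ) 1) (hxy : |x - y| ≤ δ) :
    |f x - f (max y δ)| ≤ 4 * coneConst β * oscBound β δ x := by
  have hA := coneConst_ge hβ1
  have hv : max y δ ∈ Ioc (0 : ℝ) 1 := ⟨lt_max_of_lt_right hδ0, max_le hy.2 hδ1⟩
  have hb : ∀ z ∈ Ioc (0 : ℝ) 1, f z ≤ coneConst β * z ^ (-β) := by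
    intro z hz
    have := hf.le_rpow z hz
    rwa [hm, mul_one] at this
  have hfx := hf.nonneg x hx
  have hfv := hf.nonneg _ hv
  have hX : 0 < x ^ (-β) := Real.rpow_pos_of_pos hx.1 _
  unfold oscBound
  have hx0 := hx.1
  rcases lt_or_ge x δ with h | h
  · have h1 := hf.anti hx hv (h.le.trans (le_max_right _ _))
    rw [min_eq_left ((one_le_div hx.1).2 h.le), abs_of_nonneg (by linarith)]
    have := hb x hx
    nlinarith [mul_pos (by linarith : 0 < coneConst β) hX]
  rw [min_eq_right ((div_le_one hx.1).2 h)]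
  obtain ⟨hxy1, hxy2⟩ := abs_le.1 hxy
  have hv1 : max y δ ≤ x + δ := max_le (by linarith) (by linarith)
  have hv2 : x - δ ≤ max y δ := le_trans (by linarith) (le_max_left _ _)
  have hv3 : δ ≤ max y δ := le_max_right _ _
  generalize max y δ = v at *
  -- for `u ≤ t` the two monotonicities give `f u - f t ≤ 2 f u (t - u) / t`
  have key : ∀ u ∈ Ioc (0 : ℝ) 1, ∀ t ∈ Ioc (0 : ℝ) 1, u ≤ t → t - u ≤ δ →
      0 ≤ f u - f t ∧ f u - f t ≤ 2 * f u * (δ / t) := by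
    intro u hu t ht hut hd
    refine ⟨sub_nonneg.2 (hf.anti hu ht hut), ?_⟩
    have h1 := hf.mono hu ht hut
    simp only at h1
    have hfu := hf.nonneg u hu
    have ht0 := ht.1
    rw [← mul_div_assoc, le_div_iff₀ ht0]
    have h2 : (f u - f t) * t ^ 2 ≤ f u * (t ^ 2 - u ^ 2) := by linarith
    have h3 : t ^ 2 - u ^ 2 ≤ 2 * t * δ := by nlinarith [hu.1]
    have h4 : (f u - f t) * t * t ≤ 2 * f u * δ * t := by
      have := mul_le_mul_of_nonneg_left h3 hfu
      nlinarith
    exact le_of_mul_le_mul_right h4 ht0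
  have hdx : 0 ≤ δ / x := by positivity
  have hAX : 0 < coneConst β * x ^ (-β) := by positivity
  rcases le_total x v with hxv | hvx
  · obtain ⟨h1, h2⟩ := key x hx v hv hxv (by linarith)
    rw [abs_of_nonneg h1]
    have h3 : δ / v ≤ δ / x := div_le_div_of_nonneg_left hδ0.le hx.1 hxv
    have h4 := hb x hx
    have h5 : f x * (δ / v) ≤ coneConst β * x ^ (-β) * (δ / x) :=
      mul_le_mul h4 h3 (div_nonneg hδ0.le hv.1.le) hAX.le
    nlinarith [mul_nonneg hAX.le hdx]
  · obtain ⟨h1, h2⟩ := key v hv x hx hvx (by linarith)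
    rw [abs_sub_comm, abs_of_nonneg h1]
    have h4 := hb v hv
    have h6 : v ^ (-β) ≤ 2 * x ^ (-β) := by
      have h7 : v ^ (-β) ≤ (x / 2) ^ (-β) :=
        Real.rpow_le_rpow_of_nonpos (by positivity) (by linarith) (by linarith)
      rw [Real.div_rpow hx.1.le (by norm_num), Real.rpow_neg (by norm_num : (0 : ℝ) ≤ 2),
        div_inv_eq_mul] at h7
      have h8 : (2 : ℝ) ^ β ≤ 2 := by
        calc (2 : ℝ) ^ β ≤ 2 ^ (1 : ℝ) := Real.rpow_le_rpow_of_exponent_le (by norm_num) hβ1.le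
          _ = 2 := Real.rpow_one 2
      nlinarith
    have h9 : f v ≤ 2 * (coneConst β * x ^ (-β)) := by
      have := mul_le_mul_of_nonneg_left h6 (by linarith : 0 ≤ coneConst β)
      linarith
    have := mul_le_mul_of_nonneg_right h9 hdx
    linarith

theorem oscBound_nonneg {β δ x : ℝ} (hδ0 : 0 < δ) (hx : x ∈ Ioc (0 : ℝ) 1) :
    0 ≤ oscBound β δ x := by
  have := hx.1
  unfold oscBound
  positivity

theorem integrable_oscBound {β δ : ℝ} (hβ1 : β < 1) (hδ0 : 0 < δ) :
    Integrable (oscBound β δ) unitVol := by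
  apply (integrable_rpow_neg hβ1).mono'
  · apply Measurable.aestronglyMeasurable
    unfold oscBound
    fun_prop
  · filter_upwards [ae_unitVol_mem] with x hx
    rw [Real.norm_of_nonneg (oscBound_nonneg hδ0 hx)]
    unfold oscBound
    have hX : 0 < x ^ (-β) := Real.rpow_pos_of_pos hx.1 _
    nlinarith [min_le_left 1 (δ / x)]

theorem unitVol_restrict_Ioi {δ : ℝ} (hδ0 : 0 ≤ δ) :
    unitVol.restrict (Ioi δ) = volume.restrict (Ioc δ 1) := by
  rw [unitVol, Measure.restrict_restrict measurableSet_Ioi]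
  congr 1
  ext x
  simp only [mem_inter_iff, mem_Ioi, mem_Ioc]
  constructor
  · rintro ⟨h, -, h'⟩; exact ⟨h, h'⟩
  · rintro ⟨h, h'⟩; exact ⟨h, by linarith, h'⟩

theorem integral_oscBound_le {β δ : ℝ} (hβ0 : 0 < β) (hβ1 : β < 1) (hδ0 : 0 < δ) (hδ1 : δ ≤ 1) :
    ∫ x, oscBound β δ x ∂unitVol ≤ (1 / (1 - β) + 1 / β) * δ ^ (1 - β) := by
  have hi := integrable_oscBound hβ1 hδ0
  have h1 : ∫ x in Iic δ, oscBound β δ x ∂unitVol ≤ δ ^ (1 - β) / (1 - β) := by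
    rw [← setIntegral_rpow_neg hβ1 hδ0.le hδ1]
    apply setIntegral_mono_ae_restrict hi.integrableOn
      (integrable_rpow_neg hβ1).integrableOn
    filter_upwards [ae_restrict_of_ae ae_unitVol_mem] with x hx
    unfold oscBound
    have hX : 0 < x ^ (-β) := Real.rpow_pos_of_pos hx.1 _
    nlinarith [min_le_left 1 (δ / x)]
  have hint : IntervalIntegrable (fun x : ℝ => δ * x ^ (-β - 1)) volume δ 1 := by
    apply IntervalIntegrable.const_mul
    apply intervalIntegral.intervalIntegrable_rpow
    right
    rw [uIcc_of_le hδ1]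
    exact fun h => absurd h.1 (not_le.2 hδ0)
  have h2 : ∫ x in Ioi δ, oscBound β δ x ∂unitVol ≤ δ ^ (1 - β) / β := by
    have h3 : ∫ x in Ioi δ, oscBound β δ x ∂unitVol ≤
        ∫ x in Ioi δ, δ * x ^ (-β - 1) ∂unitVol := by
      apply setIntegral_mono_ae_restrict hi.integrableOn
      · rw [intervalIntegrable_iff_integrableOn_Ioc_of_le hδ1] at hint
        unfold IntegrableOn at hint ⊢
        rwa [unitVol_restrict_Ioi hδ0.le]
      · filter_upwards [ae_restrict_of_ae ae_unitVol_mem] with x hx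
        unfold oscBound
        have hX : 0 < x ^ (-β) := Real.rpow_pos_of_pos hx.1 _
        have h4 := mul_le_mul_of_nonneg_left (min_le_right 1 (δ / x)) hX.le
        refine h4.trans (le_of_eq ?_)
        rw [Real.rpow_sub_one hx.1.ne']
        ring
    refine h3.trans ?_
    rw [unitVol_restrict_Ioi hδ0.le, integral_const_mul, ← intervalIntegral.integral_of_le hδ1,
      integral_rpow]
    · rw [sub_add_cancel, Real.one_rpow, div_neg, ← neg_div, neg_sub, ← mul_div_assoc]
      apply div_le_div_of_nonneg_right _ hβ0.le
      rw [show δ ^ (1 - β) = δ * δ ^ (-β) by rw [← Real.rpow_one_add' hδ0.le (by linarith)]; rfl]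
      nlinarith
    · right
      refine ⟨by linarith, ?_⟩
      rw [uIcc_of_le hδ1]
      exact fun h => absurd h.1 (not_le.2 hδ0)
  have h3 : ∫ x in Iic δ, oscBound β δ x ∂unitVol + ∫ x in Ioi δ, oscBound β δ x ∂unitVol =
      ∫ x, oscBound β δ x ∂unitVol := by
    rw [← compl_Iic]
    exact integral_add_compl measurableSet_Iic hi
  rw [← h3]
  calc _ ≤ δ ^ (1 - β) / (1 - β) + δ ^ (1 - β) / β := add_le_add h1 h2
    _ = _ := by ring

/-! ### Loss of memory -/

/-- If `∫_J ψ` is within `(1 - κ) |J|` of `κ |J| s`, then the same holds, up to an error, with the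
weight `φ` in place of `1`, provided that `φ` is close to a constant `c` on `J`. -/
theorem abs_setIntegral_sub_le {J : Set ℝ} {φ ψ : ℝ → ℝ} {κ s c : ℝ}
    (hφ : Integrable φ unitVol) (hψ : Measurable ψ) (hψ1 : ∀ x, |ψ x| ≤ 1)
    (hκ0 : 0 ≤ κ) (hκ1 : κ ≤ 1) (hs : |s| ≤ 1)
    (h : |∫ x in J, ψ x ∂unitVol - κ * unitVol.real J * s| ≤ (1 - κ) * unitVol.real J) :
    |∫ x in J, φ x * ψ x ∂unitVol - κ * s * ∫ x in J, φ x ∂unitVol| ≤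
      (1 - κ) * ∫ x in J, |φ x| ∂unitVol + 2 * ∫ x in J, |φ x - c| ∂unitVol := by
  have hφJ : Integrable φ (unitVol.restrict J) := hφ.restrict
  have hd : Integrable (fun x => φ x - c) (unitVol.restrict J) := hφJ.sub (integrable_const _)
  have hψJ : Integrable ψ (unitVol.restrict J) := by
    simpa using integrable_mul_bdd (integrable_const (1 : ℝ)) hψ hψ1 (μ := unitVol.restrict J)
  have e1 : ∫ x in J, φ x * ψ x ∂unitVol =
      c * ∫ x in J, ψ x ∂unitVol + ∫ x in J, (φ x - c) * ψ x ∂unitVol := by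
    rw [← integral_const_mul, ← integral_add (hψJ.const_mul c) (integrable_mul_bdd hd hψ hψ1)]
    congr 1
    ext x
    ring
  have e2 : ∫ x in J, φ x ∂unitVol = c * unitVol.real J + ∫ x in J, (φ x - c) ∂unitVol := by
    rw [integral_sub hφJ (integrable_const _), setIntegral_const, smul_eq_mul]
    ring
  set E := ∫ x in J, |φ x - c| ∂unitVol with hE
  have b1 : |∫ x in J, (φ x - c) * ψ x ∂unitVol| ≤ E := by
    refine (abs_integral_le_integral_abs).trans (integral_mono_of_nonneg
      (Filter.Eventually.of_forall fun x => abs_nonneg _) hd.abs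
      (Filter.Eventually.of_forall fun x => ?_))
    simp only
    rw [abs_mul]
    exact mul_le_of_le_one_right (abs_nonneg _) (hψ1 x)
  have b2 : |∫ x in J, (φ x - c) ∂unitVol| ≤ E := abs_integral_le_integral_abs
  have b3 : |c| * unitVol.real J ≤ ∫ x in J, |φ x| ∂unitVol + E := by
    have : |c| * unitVol.real J = ∫ x in J, |c| ∂unitVol := by
      rw [setIntegral_const, smul_eq_mul]; ring
    rw [this, hE, ← integral_add hφJ.abs hd.abs]
    apply integral_mono (integrable_const _) (hφJ.abs.add hd.abs)
    intro x
    have := abs_sub_abs_le_abs_sub c (φ x)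
    rw [abs_sub_comm c] at this
    simp only [Pi.add_apply]
    linarith
  have hE0 : 0 ≤ E := (abs_nonneg _).trans b2
  have split : ∫ x in J, φ x * ψ x ∂unitVol - κ * s * ∫ x in J, φ x ∂unitVol =
      c * (∫ x in J, ψ x ∂unitVol - κ * unitVol.real J * s) +
        ∫ x in J, (φ x - c) * ψ x ∂unitVol - κ * s * ∫ x in J, (φ x - c) ∂unitVol := by
    rw [e1, e2]; ring
  rw [split]
  have c1 : |c * (∫ x in J, ψ x ∂unitVol - κ * unitVol.real J * s)| ≤
      (1 - κ) * (∫ x in J, |φ x| ∂unitVol + E) := by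
    rw [abs_mul]
    calc _ ≤ |c| * ((1 - κ) * unitVol.real J) := mul_le_mul_of_nonneg_left h (abs_nonneg _)
      _ = (1 - κ) * (|c| * unitVol.real J) := by ring
      _ ≤ _ := mul_le_mul_of_nonneg_left b3 (by linarith)
  have c2 : |κ * s * ∫ x in J, (φ x - c) ∂unitVol| ≤ κ * E := by
    rw [abs_mul, abs_mul, abs_of_nonneg hκ0]
    have := mul_le_mul hs b2 (abs_nonneg _) zero_le_one
    nlinarith
  have := abs_sub (c * (∫ x in J, ψ x ∂unitVol - κ * unitVol.real J * s) +
        ∫ x in J, (φ x - c) * ψ x ∂unitVol) (κ * s * ∫ x in J, (φ x - c) ∂unitVol)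
  have := abs_add_le (c * (∫ x in J, ψ x ∂unitVol - κ * unitVol.real J * s))
        (∫ x in J, (φ x - c) * ψ x ∂unitVol)
  linarith

/-- The scale of the cells of prefix length `q`, raised to the power `1 - β`: the order of the
mass that a cone density gives to an interval `(0, δ]` of this length `δ`. -/
noncomputable def cellErr (β : ℝ) (q : ℕ) : ℝ := (min 1 (diamBound β q)) ^ (1 - β)

/-- A block of `2 q` steps contracts differences of cone densities, up to an error. The difference
is almost constant on the cells, and each cell spreads over the interval within the block. -/
theorem exists_block_contraction {β : ℝ} (hβ0 : 0 < β) (hβ1 : β < 1) :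
    ∃ κ C : ℝ, 0 < κ ∧ κ ≤ 1 ∧ 0 < C ∧ ∀ α, Adm β α → ∀ q : ℕ, 1 ≤ q →
      ∀ f g, Cone β f → Cone β g → ∫ x, f x ∂unitVol = 1 → ∫ x, g x ∂unitVol = 1 →
      ∀ ψ : ℝ → ℝ, Measurable ψ → (∀ x, |ψ x| ≤ 1) →
      |∫ x, (f x - g x) * ψ (orbit α (2 * q) x) ∂unitVol| ≤
        (1 - κ) * ∫ x, |f x - g x| ∂unitVol + C * cellErr β q := by
  obtain ⟨κ, hκ0, hκ1, hκ⟩ := exists_cell_minorization hβ0 hβ1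
  have hA := coneConst_ge hβ1
  have hb : 0 < 1 - β := by linarith
  refine ⟨κ, 16 * coneConst β * (1 / (1 - β) + 1 / β) + 4 * (coneConst β / (1 - β)),
    hκ0, hκ1, by positivity, fun α hα q hq f g hf hg hf1 hg1 ψ hψ hψ1 => ?_⟩
  have hq0 : (0 : ℝ) < q := by exact_mod_cast hq
  set δ := min 1 (diamBound β q) with hδ
  have hδ0 : 0 < δ := by
    have : 0 < diamBound β q := by unfold diamBound; positivity
    exact lt_min one_pos this
  have hδ1 : δ ≤ 1 := min_le_left _ _
  set φ := fun x => f x - g x with hφd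
  have hφ : Integrable φ unitVol := hf.integrable.sub hg.integrable
  set Ψ := fun x => ψ (orbit α (2 * q) x)
  have hΨ : Measurable Ψ := hψ.comp (measurable_orbit _ _)
  have hΨ1 : ∀ x, |Ψ x| ≤ 1 := fun x => hψ1 _
  set s := ∫ x, ψ x ∂unitVol
  have hψi : Integrable ψ unitVol := by
    simpa using integrable_mul_bdd (integrable_const (1 : ℝ)) hψ hψ1 (μ := unitVol)
  have hs : |s| ≤ 1 := by
    have h1 : |s| ≤ ∫ x, |ψ x| ∂unitVol := abs_integral_le_integral_abs
    have h2 : ∫ x, |ψ x| ∂unitVol ≤ ∫ _, (1 : ℝ) ∂unitVol :=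
      integral_mono hψi.abs (integrable_const _) hψ1
    simp at h2
    linarith
  have hosc := integrable_oscBound hβ1 hδ0
  -- the estimate on a single cell
  have hcell : ∀ i : (Fin q → Bool) × Fin q,
      |∫ x in cell α q (i.1, i.2), φ x * Ψ x ∂unitVol -
          κ * s * ∫ x in cell α q (i.1, i.2), φ x ∂unitVol| ≤
        (1 - κ) * ∫ x in cell α q (i.1, i.2), |φ x| ∂unitVol +
          16 * coneConst β * ∫ x in cell α q (i.1, i.2), oscBound β δ x ∂unitVol := by
    rintro ⟨w, j⟩
    set J := cell α q (w, (j : ℕ)) with hI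
    have hΨJ : Integrable Ψ (unitVol.restrict J) := by
      simpa using integrable_mul_bdd (integrable_const (1 : ℝ)) hΨ hΨ1 (μ := unitVol.restrict J)
    have hD : |∫ x in J, Ψ x ∂unitVol - κ * unitVol.real J * s| ≤ (1 - κ) * unitVol.real J := by
      have hj := j.2
      have h1 := hκ α hα q (w, j) (2 * q) (by simp only; omega) (fun x => 1 - ψ x) 2
        (measurable_const.sub hψ) (fun x => by linarith [(abs_le.1 (hψ1 x)).2])
        (fun x => by linarith [(abs_le.1 (hψ1 x)).1])
      have h2 := hκ α hα q (w, j) (2 * q) (by simp only; omega) (fun x => 1 + ψ x) 2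
        (measurable_const.add hψ) (fun x => by linarith [(abs_le.1 (hψ1 x)).1])
        (fun x => by linarith [(abs_le.1 (hψ1 x)).2])
      rw [integral_sub (integrable_const _) hψi,
        integral_sub (integrable_const _) hΨJ] at h1
      rw [integral_add (integrable_const _) hψi,
        integral_add (integrable_const _) hΨJ] at h2
      simp only [integral_const, smul_eq_mul, mul_one, probReal_univ, measureReal_restrict_apply_univ]
        at h1 h2
      rw [abs_le]
      constructor <;> linarith
    by_cases hne : ∃ y, y ∈ J ∧ y ∈ Ioc (0 : ℝ) 1
    · obtain ⟨y, hyJ, hy⟩ := hne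
      have h1 := abs_setIntegral_sub_le (c := f (max y δ) - g (max y δ)) hφ hΨ hΨ1 hκ0.le hκ1 hs hD
      have h2 : ∫ x in J, |φ x - (f (max y δ) - g (max y δ))| ∂unitVol ≤
          ∫ x in J, 8 * coneConst β * oscBound β δ x ∂unitVol := by
        apply setIntegral_mono_ae_restrict
        · exact (hφ.sub (integrable_const _)).abs.integrableOn
        · exact (hosc.const_mul _).integrableOn
        filter_upwards [ae_restrict_mem (measurableSet_cell α q _), ae_restrict_of_ae ae_unitVol_mem]
          with x hxJ hx
        have hxy : |x - y| ≤ δ := by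
          apply le_min
          · rw [abs_le]; constructor <;> linarith [hx.1, hx.2, hy.1, hy.2]
          · exact cell_dist_le hβ0 hβ1 hα (s := 0) hq _ ⟨hx.1.le, hx.2⟩ ⟨hy.1.le, hy.2⟩ hxJ hyJ
        have o1 := hf.osc_le hβ0 hβ1 hf1 hδ0 hδ1 hx hy hxy
        have o2 := hg.osc_le hβ0 hβ1 hg1 hδ0 hδ1 hx hy hxy
        have o3 := abs_sub (f x - f (max y δ)) (g x - g (max y δ))
        have o4 : φ x - (f (max y δ) - g (max y δ)) =
            f x - f (max y δ) - (g x - g (max y δ)) := by simp only [hφd]; ring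
        rw [o4]
        linarith
      rw [integral_const_mul] at h2
      linarith
    · have hz : unitVol.restrict J = 0 := by
        rw [Measure.restrict_eq_zero, measure_eq_zero_iff_ae_notMem]
        filter_upwards [ae_unitVol_mem] with x hx hxJ
        exact hne ⟨x, hxJ, hx⟩
      simp [hz]
  have hφΨ : Integrable (fun x => φ x * Ψ x) unitVol := integrable_mul_bdd hφ hΨ hΨ1
  have t0 : ∫ x, φ x ∂unitVol = 0 := by
    rw [hφd, integral_sub hf.integrable hg.integrable, hf1, hg1, sub_self]
  set b := ∫ x in tail α q q, |φ x| ∂unitVol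
  have s1 := integral_eq_sum_cell α q q hφΨ
  have s2 := integral_eq_sum_cell α q q hφ
  rw [t0] at s2
  have s3 := sum_cell_le α q q hφ.abs (fun x _ => abs_nonneg _)
  have s4 := sum_cell_le α q q hosc (fun x hx => oscBound_nonneg hδ0 hx)
  have s5 := integral_oscBound_le hβ0 hβ1 hδ0 hδ1
  have s6 : b ≤ 2 * (coneConst β / (1 - β)) * δ ^ (1 - β) := by
    have h1 := hf.setIntegral_tail_le hβ0 hβ1 hα q hq
    have h2 := hg.setIntegral_tail_le hβ0 hβ1 hα q hq
    rw [hf1, mul_one] at h1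
    rw [hg1, mul_one] at h2
    have h3 : b ≤ ∫ x in tail α q q, (f x + g x) ∂unitVol := by
      apply setIntegral_mono_ae_restrict hφ.abs.integrableOn
        (hf.integrable.add hg.integrable).integrableOn
      filter_upwards [ae_restrict_of_ae ae_unitVol_mem] with x hx
      have := hf.nonneg x hx
      have := hg.nonneg x hx
      simp only [hφd, Pi.add_apply]
      rw [abs_le]
      constructor <;> linarith
    rw [integral_add hf.integrable.integrableOn hg.integrable.integrableOn] at h3
    linarith
  have s7 : |∫ x in tail α q q, φ x * Ψ x ∂unitVol| ≤ b := by
    refine (abs_integral_le_integral_abs).trans (integral_mono_of_nonneg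
      (Filter.Eventually.of_forall fun x => abs_nonneg _) hφ.abs.restrict
      (Filter.Eventually.of_forall fun x => ?_))
    simp only
    rw [abs_mul]
    exact mul_le_of_le_one_right (abs_nonneg _) (hΨ1 x)
  have s8 : |∫ x in tail α q q, φ x ∂unitVol| ≤ b := abs_integral_le_integral_abs
  have hsum := Finset.sum_le_sum fun i (_ : i ∈ Finset.univ) => hcell i
  have habs := Finset.abs_sum_le_sum_abs (fun i : (Fin q → Bool) × Fin q =>
    ∫ x in cell α q (i.1, i.2), φ x * Ψ x ∂unitVol -
          κ * s * ∫ x in cell α q (i.1, i.2), φ x ∂unitVol) Finset.univ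
  rw [Finset.sum_add_distrib, ← Finset.mul_sum, ← Finset.mul_sum] at hsum
  rw [Finset.sum_sub_distrib, ← Finset.mul_sum] at habs
  have hfin : ∫ x, φ x * Ψ x ∂unitVol =
      (∑ i : (Fin q → Bool) × Fin q, ∫ x in cell α q (i.1, i.2), φ x * Ψ x ∂unitVol -
        κ * s * ∑ i : (Fin q → Bool) × Fin q, ∫ x in cell α q (i.1, i.2), φ x ∂unitVol) +
      (∫ x in tail α q q, φ x * Ψ x ∂unitVol - κ * s * ∫ x in tail α q q, φ x ∂unitVol) := by
    rw [s1]
    have : ∑ i : (Fin q → Bool) × Fin q, ∫ x in cell α q (i.1, i.2), φ x ∂unitVol =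
      - ∫ x in tail α q q, φ x ∂unitVol := by linarith
    rw [this]
    ring
  have s9 : |κ * s * ∫ x in tail α q q, φ x ∂unitVol| ≤ b := by
    rw [abs_mul, abs_mul, abs_of_pos hκ0]
    have h1 : κ * |s| ≤ 1 := by nlinarith [abs_nonneg s]
    have h2 : 0 ≤ κ * |s| := by positivity
    nlinarith [abs_nonneg (∫ x in tail α q q, φ x ∂unitVol)]
  have s10 := abs_sub (∫ x in tail α q q, φ x * Ψ x ∂unitVol)
    (κ * s * ∫ x in tail α q q, φ x ∂unitVol)
  have s11 : (1 - κ) * ∑ i : (Fin q → Bool) × Fin q, ∫ x in cell α q (i.1, i.2), |φ x| ∂unitVol ≤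
      (1 - κ) * ∫ x, |φ x| ∂unitVol := mul_le_mul_of_nonneg_left s3 (by linarith)
  have s12 : 16 * coneConst β *
      ∑ i : (Fin q → Bool) × Fin q, ∫ x in cell α q (i.1, i.2), oscBound β δ x ∂unitVol ≤
      16 * coneConst β * ((1 / (1 - β) + 1 / β) * δ ^ (1 - β)) :=
    mul_le_mul_of_nonneg_left (s4.trans s5) (by linarith)
  change |∫ x, φ x * Ψ x ∂unitVol| ≤ (1 - κ) * ∫ x, |φ x| ∂unitVol + _ * δ ^ (1 - β)
  rw [hfin]
  refine (abs_add_le _ _).trans ?_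
  linarith

theorem integral_orbit_sub {β : ℝ} (hβ1 : β < 1) {α : ℕ → ℝ} (hα : Adm β α) {f g : ℝ → ℝ}
    (hf : Cone β f) (hg : Cone β g) (N : ℕ) {ψ : ℝ → ℝ} (hψ : Measurable ψ) {B : ℝ}
    (hB : ∀ x, |ψ x| ≤ B) :
    ∫ x, (trN α f N x - trN α g N x) * ψ x ∂unitVol =
      ∫ x, (f x - g x) * ψ (orbit α N x) ∂unitVol := by
  have hψ' : Measurable fun x => ψ (orbit α N x) := hψ.comp (measurable_orbit _ _)
  simp only [sub_mul]
  rw [integral_sub (integrable_mul_bdd (hf.trN hβ1 hα N).integrable hψ hB)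
    (integrable_mul_bdd (hg.trN hβ1 hα N).integrable hψ hB),
    integral_sub (integrable_mul_bdd hf.integrable hψ' fun x => hB _)
    (integrable_mul_bdd hg.integrable hψ' fun x => hB _), integral_trN hβ1 hα hf N hψ hB,
    integral_trN hβ1 hα hg N hψ hB]

/-- The `L¹` norm of an integrable function is attained at a measurable sign. -/
theorem exists_integral_abs_eq {μ : Measure ℝ} {h : ℝ → ℝ} (hh : Integrable h μ) :
    ∃ ψ : ℝ → ℝ, Measurable ψ ∧ (∀ x, |ψ x| ≤ 1) ∧ ∫ x, |h x| ∂μ = ∫ x, h x * ψ x ∂μ := by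
  set k := hh.aestronglyMeasurable.mk h with hk
  have hkm : Measurable k := hh.aestronglyMeasurable.stronglyMeasurable_mk.measurable
  refine ⟨fun x => if 0 ≤ k x then 1 else -1, ?_, ?_, ?_⟩
  · exact Measurable.ite (hkm measurableSet_Ici) measurable_const measurable_const
  · intro x
    simp only
    split_ifs <;> simp
  · apply integral_congr_ae
    filter_upwards [hh.aestronglyMeasurable.ae_eq_mk] with x hx
    rw [hx]
    split_ifs with h0
    · rw [mul_one]; exact abs_of_nonneg h0
    · rw [mul_neg_one]; exact abs_of_neg (not_le.1 h0)

/-- Iteration of the block contraction. -/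
theorem exists_iterated_contraction {β : ℝ} (hβ0 : 0 < β) (hβ1 : β < 1) :
    ∃ κ C : ℝ, 0 < κ ∧ κ ≤ 1 ∧ 0 < C ∧ ∀ α, Adm β α → ∀ q : ℕ, 1 ≤ q → ∀ k n : ℕ, k * (2 * q) ≤ n →
      ∀ f g, Cone β f → Cone β g → ∫ x, f x ∂unitVol = 1 → ∫ x, g x ∂unitVol = 1 →
      ∀ ψ : ℝ → ℝ, Measurable ψ → (∀ x, |ψ x| ≤ 1) →
      |∫ x, (f x - g x) * ψ (orbit α n x) ∂unitVol| ≤ 2 * (1 - κ) ^ k + C * cellErr β q := by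
  obtain ⟨κ, C, hκ0, hκ1, hC, H⟩ := exists_block_contraction hβ0 hβ1
  refine ⟨κ, C / κ, hκ0, hκ1, by positivity, fun α hα q hq k n hkn f g hf hg hf1 hg1 ψ hψ hψ1 => ?_⟩
  have hE : 0 ≤ cellErr β q := by
    have : 0 ≤ diamBound β q := by unfold diamBound; positivity
    unfold cellErr
    positivity
  have key : ∀ k : ℕ, ∫ x, |trN α f (k * (2 * q)) x - trN α g (k * (2 * q)) x| ∂unitVol ≤
      2 * (1 - κ) ^ k + C / κ * cellErr β q := by
    intro k
    induction k with
    | zero =>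
      have h1 : ∫ x, |f x - g x| ∂unitVol ≤ ∫ x, (f x + g x) ∂unitVol := by
        apply integral_mono_ae (hf.integrable.sub hg.integrable).abs
          (hf.integrable.add hg.integrable)
        filter_upwards [ae_unitVol_mem] with x hx
        have := hf.nonneg x hx
        have := hg.nonneg x hx
        simp only [Pi.add_apply, Pi.sub_apply]
        rw [abs_le]
        constructor <;> linarith
      rw [integral_add hf.integrable hg.integrable, hf1, hg1] at h1
      have h2 : 0 ≤ C / κ * cellErr β q := by positivity
      simp only [zero_mul, trN, pow_zero, mul_one]
      linarith
    | succ k ih =>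
      set m := k * (2 * q)
      have hF := hf.trN hβ1 hα m
      have hG := hg.trN hβ1 hα m
      have e : (k + 1) * (2 * q) = m + 2 * q := by simp only [m]; ring
      rw [e]
      obtain ⟨θ, hθ, hθ1, hθe⟩ := exists_integral_abs_eq
        ((hf.trN hβ1 hα (m + 2 * q)).integrable.sub (hg.trN hβ1 hα (m + 2 * q)).integrable)
      simp only [Pi.sub_apply] at hθe
      rw [hθe, integral_orbit_sub hβ1 hα hf hg _ hθ hθ1]
      simp only [orbit_add]
      rw [← integral_orbit_sub hβ1 hα hf hg m (ψ := fun x => θ (orbit (shift α m) (2 * q) x))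
        (hθ.comp (measurable_orbit _ _)) (fun x => hθ1 _)]
      have h1 := H (shift α m) (hα.shift m) q hq _ _ hF hG
        (by rw [integral_trN_one hβ1 hα hf, hf1]) (by rw [integral_trN_one hβ1 hα hg, hg1]) θ hθ hθ1
      have h2 := mul_le_mul_of_nonneg_left ih (by linarith : 0 ≤ 1 - κ)
      have h3 : (1 - κ) * (C / κ * cellErr β q) + C * cellErr β q = C / κ * cellErr β q := by
        field_simp
        ring
      refine (le_abs_self _).trans (h1.trans ?_)
      rw [pow_succ]
      linarith
  obtain ⟨r, rfl⟩ := Nat.exists_eq_add_of_le hkn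
  set m := k * (2 * q)
  simp only [orbit_add]
  have hψ' : Measurable fun x => ψ (orbit (shift α m) r x) := hψ.comp (measurable_orbit _ _)
  rw [← integral_orbit_sub hβ1 hα hf hg m hψ' (fun x => hψ1 _)]
  have hi := (hf.trN hβ1 hα m).integrable.sub (hg.trN hβ1 hα m).integrable
  refine le_trans ?_ (key k)
  refine (abs_integral_le_integral_abs).trans (integral_mono_of_nonneg
    (Filter.Eventually.of_forall fun x => abs_nonneg _) hi.abs
    (Filter.Eventually.of_forall fun x => ?_))
  simp only
  rw [abs_mul]
  exact mul_le_of_le_one_right (abs_nonneg _) (hψ1 _)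

/-! ### Rates -/

theorem rho_of_two_le {β : ℝ} {n : ℕ} (hn : 2 ≤ n) :
    rho β n = (n : ℝ) ^ (-(1 / β - 1)) * Real.log n ^ (1 / β) := by
  rw [rho, if_neg (by omega)]
  congr 2
  ring

theorem half_le_log {n : ℕ} (hn : 2 ≤ n) : 1 / 2 ≤ Real.log n := by
  have h1 := Real.log_two_gt_d9
  have h2 : Real.log 2 ≤ Real.log n := Real.log_le_log (by norm_num) (by exact_mod_cast hn)
  linarith

theorem rho_pos (β : ℝ) (n : ℕ) : 0 < rho β n := by
  rcases lt_or_ge n 2 with h | h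
  · rw [rho, if_pos (by omega)]
    exact one_pos
  · have h1 := half_le_log h
    have h2 : (0 : ℝ) < n := by exact_mod_cast (by omega : 0 < n)
    have h3 : 0 < Real.log n := by linarith
    rw [rho_of_two_le h]
    positivity

theorem exponent_pos {β : ℝ} (hβ0 : 0 < β) (hβ1 : β < 1) : 0 < 1 / β - 1 :=
  sub_pos.2 ((one_lt_div hβ0).2 hβ1)

/-- The polynomial part of the rate is dominated by `rho`. -/
theorem rpow_le_rho {β : ℝ} (hβ0 : 0 < β) {n : ℕ} (hn : 2 ≤ n) :
    (n : ℝ) ^ (-(1 / β - 1)) ≤ 2 ^ (1 / β) * rho β n := by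
  have h1 : 1 ≤ (2 * Real.log n) ^ (1 / β) :=
    Real.one_le_rpow (by linarith [half_le_log hn]) (by positivity)
  rw [Real.mul_rpow (by norm_num) (by linarith [half_le_log hn])] at h1
  rw [rho_of_two_le hn]
  have h2 : (0 : ℝ) ≤ (n : ℝ) ^ (-(1 / β - 1)) := by positivity
  nlinarith

theorem rho_le_of_half {β : ℝ} (hβ0 : 0 < β) (hβ1 : β < 1) {n r : ℕ} (hr : 2 ≤ r) (hrn : r ≤ n)
    (hnr : n ≤ 2 * r) : rho β r ≤ 2 ^ (1 / β - 1) * rho β n := by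
  have hp := exponent_pos hβ0 hβ1
  rw [rho_of_two_le hr, rho_of_two_le (hr.trans hrn), ← mul_assoc]
  have hr0 : (0 : ℝ) < r := by exact_mod_cast (by omega : 0 < r)
  have hn0 : (0 : ℝ) < n := by exact_mod_cast (by omega : 0 < n)
  have hlr := half_le_log hr
  have hrn' : (r : ℝ) ≤ n := by exact_mod_cast hrn
  have hnr' : (n : ℝ) ≤ 2 * r := by exact_mod_cast hnr
  apply mul_le_mul _ _ (by positivity) (by positivity)
  · calc (r : ℝ) ^ (-(1 / β - 1)) ≤ (n / 2 : ℝ) ^ (-(1 / β - 1)) :=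
          Real.rpow_le_rpow_of_nonpos (by positivity) (by linarith) (by linarith)
      _ = _ := by
        rw [Real.div_rpow hn0.le (by norm_num), Real.rpow_neg (by norm_num : (0 : ℝ) ≤ 2),
          div_inv_eq_mul, mul_comm]
  · exact Real.rpow_le_rpow (by linarith) (Real.log_le_log hr0 hrn') (by positivity)

theorem one_le_rho_of_le_four {β : ℝ} (hβ0 : 0 < β) (hβ1 : β < 1) {n : ℕ} (hn : n ≤ 4) :
    1 ≤ 4 ^ (1 / β - 1) * 2 ^ (1 / β) * rho β n := by
  have hp := exponent_pos hβ0 hβ1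
  have h4 : (1 : ℝ) ≤ 4 ^ (1 / β - 1) := Real.one_le_rpow (by norm_num) hp.le
  rcases lt_or_ge n 2 with h | h
  · rw [rho, if_pos (by omega), mul_one]
    have h2 : (1 : ℝ) ≤ 2 ^ (1 / β) := Real.one_le_rpow (by norm_num) (by positivity)
    nlinarith
  · have h1 := rpow_le_rho hβ0 h
    have hn0 : (0 : ℝ) < n := by exact_mod_cast (by omega : 0 < n)
    have h2 : (4 : ℝ) ^ (-(1 / β - 1)) ≤ (n : ℝ) ^ (-(1 / β - 1)) :=
      Real.rpow_le_rpow_of_nonpos hn0 (by exact_mod_cast hn) (by linarith)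
    have h3 : (4 : ℝ) ^ (1 / β - 1) * 4 ^ (-(1 / β - 1)) = 1 := by
      rw [← Real.rpow_add (by norm_num)]; simp
    have h5 := mul_le_mul_of_nonneg_left (h2.trans h1) (by linarith : (0 : ℝ) ≤ 4 ^ (1 / β - 1))
    linarith

theorem cellErr_le {β : ℝ} (hβ0 : 0 < β) (hβ1 : β < 1) (q : ℕ) :
    cellErr β q ≤ (2 / β) ^ (1 / β - 1) * (q : ℝ) ^ (-(1 / β - 1)) := by
  have hd : 0 ≤ diamBound β q := by unfold diamBound; positivity
  unfold cellErr
  calc (min 1 (diamBound β q)) ^ (1 - β) ≤ (diamBound β q) ^ (1 - β) :=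
        Real.rpow_le_rpow (le_min zero_le_one hd) (min_le_right _ _) (by linarith)
    _ = (2 / β / q) ^ (1 / β - 1) := by
        unfold diamBound
        rw [← Real.rpow_mul (by positivity)]
        congr 1
        · rw [div_div]
        · field_simp
    _ = _ := by
        rw [Real.div_rpow (by positivity) (by positivity), Real.rpow_neg (by positivity)]
        rfl

/-- The step of a telescoping comparison of `∑ r ^ (-(p + 1))` with `q ^ (-p)`. -/
theorem rpow_succ_le_sub {p : ℝ} (hp : 0 < p) {r : ℕ} (hr : 1 ≤ r) :
    (r : ℝ) ^ (-(p + 1)) ≤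
      2 ^ (p + 1) / p * ((r : ℝ) ^ (-p) - ((r + 1 : ℕ) : ℝ) ^ (-p)) := by
  have hr0 : (0 : ℝ) < r := by exact_mod_cast hr
  have hr1 : (1 : ℝ) ≤ r := by exact_mod_cast hr
  push_cast
  set R : ℝ := r + 1 with hR
  have hR0 : 0 < R := by positivity
  have hx : 0 < 1 - 1 / R := by
    rw [sub_pos, div_lt_one hR0]; linarith
  have h1 : 1 + p * (1 / R) ≤ (1 - 1 / R) ^ (-p) := by
    rw [Real.rpow_def_of_pos hx]
    have h2 := Real.log_le_sub_one_of_pos hx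
    have h3 := Real.add_one_le_exp (Real.log (1 - 1 / R) * -p)
    nlinarith
  have h2 : (r : ℝ) ^ (-p) = R ^ (-p) * (1 - 1 / R) ^ (-p) := by
    rw [← Real.mul_rpow hR0.le hx.le]
    congr 1
    rw [mul_sub, mul_one_div_cancel hR0.ne']
    linarith
  have hRp : 0 < R ^ (-p) := Real.rpow_pos_of_pos hR0 _
  have h3 : p * R ^ (-(p + 1)) ≤ (r : ℝ) ^ (-p) - R ^ (-p) := by
    have h4 : R ^ (-(p + 1)) = R ^ (-p) * (1 / R) := by
      rw [neg_add, ← sub_eq_add_neg, Real.rpow_sub_one hR0.ne']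
      ring
    rw [h2, h4]
    have := mul_le_mul_of_nonneg_left h1 hRp.le
    linarith
  have h5 : (r : ℝ) ^ (-(p + 1)) ≤ 2 ^ (p + 1) * R ^ (-(p + 1)) := by
    have h6 : (r : ℝ) ^ (-(p + 1)) ≤ (R / 2) ^ (-(p + 1)) :=
      Real.rpow_le_rpow_of_nonpos (by positivity) (by linarith) (by linarith)
    rwa [Real.div_rpow hR0.le (by norm_num), Real.rpow_neg (by norm_num : (0 : ℝ) ≤ 2),
      div_inv_eq_mul, mul_comm] at h6
  calc (r : ℝ) ^ (-(p + 1)) ≤ 2 ^ (p + 1) * R ^ (-(p + 1)) := h5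
    _ = 2 ^ (p + 1) / p * (p * R ^ (-(p + 1))) := by field_simp
    _ ≤ _ := mul_le_mul_of_nonneg_left h3 (by positivity)

theorem sum_rpow_le {p : ℝ} (hp : 0 < p) {q : ℕ} (hq : 1 ≤ q) (n : ℕ) :
    ∑ r ∈ Finset.range n, ((q + r : ℕ) : ℝ) ^ (-(p + 1)) ≤ 2 ^ (p + 1) / p * (q : ℝ) ^ (-p) := by
  have h : ∑ r ∈ Finset.range n, ((q + r : ℕ) : ℝ) ^ (-(p + 1)) ≤
      2 ^ (p + 1) / p * ((q : ℝ) ^ (-p) - ((q + n : ℕ) : ℝ) ^ (-p)) := by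
    induction n with
    | zero => simp
    | succ n ih =>
      rw [Finset.sum_range_succ]
      have := rpow_succ_le_sub hp (show 1 ≤ q + n by omega)
      rw [← add_assoc]
      linarith
  refine h.trans (mul_le_mul_of_nonneg_left ?_ (by positivity))
  have : (0 : ℝ) ≤ ((q + n : ℕ) : ℝ) ^ (-p) := by positivity
  linarith

/-- The diameters at the times `n i ≤ t` of a cylinder of length `t + q` have a sum of the order of
the rate at `q`, up to the multiplicity of the times. -/
theorem sum_diamBound_le {β : ℝ} (hβ0 : 0 < β) (hβ1 : β < 1) {S : Finset ℕ} {n : ℕ → ℕ}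
    {t q M : ℕ} (hq : 1 ≤ q) (hn : ∀ i ∈ S, n i ≤ t)
    (hM : ∀ v, (S.filter fun i => n i = v).card ≤ M) :
    ∑ i ∈ S, diamBound β (t + q - n i) ≤
      M * ((2 / β) ^ (1 / β) * (2 ^ (1 / β) / (1 / β - 1)) * (q : ℝ) ^ (-(1 / β - 1))) := by
  have hp := exponent_pos hβ0 hβ1
  have hd0 : ∀ r, 0 ≤ diamBound β r := fun r => by unfold diamBound; positivity
  have h1 : ∑ i ∈ S, diamBound β (t + q - n i) ≤
      ∑ v ∈ Finset.range (t + 1), M * diamBound β (t + q - v) := by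
    rw [← Finset.sum_fiberwise_of_maps_to (t := Finset.range (t + 1)) (g := n)
      (fun i hi => Finset.mem_range.2 (by have := hn i hi; omega))]
    apply Finset.sum_le_sum
    intro v _
    calc ∑ i ∈ S with n i = v, diamBound β (t + q - n i)
        = ∑ i ∈ S with n i = v, diamBound β (t + q - v) := by
          apply Finset.sum_congr rfl
          intro i hi
          rw [(Finset.mem_filter.1 hi).2]
      _ = (S.filter fun i => n i = v).card * diamBound β (t + q - v) := by
          rw [Finset.sum_const, nsmul_eq_mul]
      _ ≤ _ := mul_le_mul_of_nonneg_right (by exact_mod_cast hM v) (hd0 _)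
  have h2 : ∑ v ∈ Finset.range (t + 1), diamBound β (t + q - v) =
      ∑ r ∈ Finset.range (t + 1), diamBound β (q + r) := by
    rw [← Finset.sum_range_reflect]
    apply Finset.sum_congr rfl
    intro v hv
    have := Finset.mem_range.1 hv
    congr 1
    omega
  have h3 : ∀ r, diamBound β r = (2 / β) ^ (1 / β) * (r : ℝ) ^ (-(1 / β - 1 + 1)) := by
    intro r
    unfold diamBound
    rw [← div_div, Real.div_rpow (by positivity) (by positivity), sub_add_cancel,
      Real.rpow_neg (by positivity)]
    rfl
  have h4 := sum_rpow_le hp hq (t + 1)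
  rw [← Finset.mul_sum, h2] at h1
  refine h1.trans (mul_le_mul_of_nonneg_left ?_ (by positivity))
  simp only [h3, ← Finset.mul_sum]
  rw [sub_add_cancel] at h4 ⊢
  rw [mul_assoc]
  exact mul_le_mul_of_nonneg_left h4 (by positivity)

/-! ### Polynomial loss of memory -/

/-- Loss of memory at the rate `rho`: about `log n` blocks of length `n / log n` are used. -/
theorem exists_memory_loss {β : ℝ} (hβ0 : 0 < β) (hβ1 : β < 1) :
    ∃ C : ℝ, 0 < C ∧ ∀ α, Adm β α → ∀ n : ℕ, 2 ≤ n →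
      ∀ f g, Cone β f → Cone β g → ∫ x, f x ∂unitVol = 1 → ∫ x, g x ∂unitVol = 1 →
      ∀ ψ : ℝ → ℝ, Measurable ψ → (∀ x, |ψ x| ≤ 1) →
      |∫ x, (f x - g x) * ψ (orbit α n x) ∂unitVol| ≤ C * rho β n := by
  obtain ⟨κ, C, hκ0, hκ1, hC, H⟩ := exists_iterated_contraction hβ0 hβ1
  have hp := exponent_pos hβ0 hβ1
  have hpe : 1 / β = (1 / β - 1) + 1 := by ring
  set p := 1 / β - 1 with hpd
  set D := C * (2 / β) ^ p with hD
  set k₀ := p / κ + 2 with hk₀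
  have hD0 : 0 < D := by positivity
  have hk₀0 : 0 < k₀ := by positivity
  refine ⟨2 * 2 ^ (1 / β) + (2 + D) * (4 * k₀) ^ p * 2, by positivity,
    fun α hα n hn f g hf hg hf1 hg1 ψ hψ hψ1 => ?_⟩
  have hn0 : (0 : ℝ) < n := by exact_mod_cast (by omega : 0 < n)
  have hL := half_le_log hn
  have hL0 : 0 < Real.log n := by linarith
  set L := Real.log n with hLd
  set k := ⌈p / κ * L⌉₊ with hk
  have hk1 : p / κ * L ≤ k := Nat.le_ceil _
  have hk2 : (k : ℝ) ≤ k₀ * L := by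
    have := Nat.ceil_lt_add_one (by positivity : 0 ≤ p / κ * L)
    rw [hk₀]
    nlinarith
  have hk0 : 0 < k := Nat.ceil_pos.2 (by positivity)
  have hk0' : (0 : ℝ) < k := by exact_mod_cast hk0
  have hrho : rho β n = (n : ℝ) ^ (-p) * (L ^ p * L) := by
    rw [rho_of_two_le hn, ← Real.rpow_add_one hL0.ne', ← hpe]
  have hX : 0 < (n : ℝ) ^ (-p) := Real.rpow_pos_of_pos hn0 _
  -- the loss of scale by dividing into `k` blocks
  have hmain : (n : ℝ) ^ (-p) * (4 * k) ^ p ≤ (4 * k₀) ^ p * 2 * rho β n := by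
    have h1 : (4 * k : ℝ) ^ p ≤ (4 * k₀ * L) ^ p :=
      Real.rpow_le_rpow (by positivity) (by linarith) hp.le
    rw [Real.mul_rpow (by positivity) hL0.le] at h1
    have h2 : L ^ p ≤ 2 * (L ^ p * L) := by
      have : 0 < L ^ p := Real.rpow_pos_of_pos hL0 _
      nlinarith
    rw [hrho]
    calc (n : ℝ) ^ (-p) * (4 * k) ^ p ≤ (n : ℝ) ^ (-p) * ((4 * k₀) ^ p * (2 * (L ^ p * L))) := by
          apply mul_le_mul_of_nonneg_left _ hX.le
          exact h1.trans (mul_le_mul_of_nonneg_left h2 (by positivity))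
      _ = _ := by ring
  have hdecay : (1 - κ) ^ k ≤ (n : ℝ) ^ (-p) := by
    have h1 : 1 - κ ≤ Real.exp (-κ) := by linarith [Real.add_one_le_exp (-κ)]
    calc (1 - κ) ^ k ≤ Real.exp (-κ) ^ k := pow_le_pow_left₀ (by linarith) h1 k
      _ = Real.exp (k * -κ) := (Real.exp_nat_mul _ _).symm
      _ ≤ Real.exp (L * -p) := by
        apply Real.exp_le_exp.2
        rw [div_mul_eq_mul_div, div_le_iff₀ hκ0] at hk1
        linarith
      _ = (n : ℝ) ^ (-p) := by rw [Real.rpow_def_of_pos hn0]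
  have hrho0 := rho_pos β n
  rcases le_or_gt (2 * k) n with hkn | hkn
  · set q := n / (2 * k) with hq
    have hq1 : 1 ≤ q := (Nat.one_le_div_iff (by omega)).2 hkn
    have hq0 : (0 : ℝ) < q := by exact_mod_cast hq1
    have hqn : k * (2 * q) ≤ n := by
      have := Nat.div_mul_le_self n (2 * k)
      rw [← hq] at this
      linarith
    have hnq : (n : ℝ) / (4 * k) ≤ q := by
      rw [div_le_iff₀ (by positivity)]
      have h1 : n < 2 * k * (q + 1) := Nat.lt_mul_div_succ n (by omega)
      have h2 : n ≤ q * (4 * k) := by nlinarith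
      exact_mod_cast h2
    have h1 := H α hα q hq1 k n hqn f g hf hg hf1 hg1 ψ hψ hψ1
    have h2 := cellErr_le hβ0 hβ1 q
    have h3 : (q : ℝ) ^ (-p) ≤ (n : ℝ) ^ (-p) * (4 * k) ^ p := by
      calc (q : ℝ) ^ (-p) ≤ ((n : ℝ) / (4 * k)) ^ (-p) :=
            Real.rpow_le_rpow_of_nonpos (by positivity) hnq (by linarith)
        _ = _ := by
          rw [Real.div_rpow hn0.le (by positivity), Real.rpow_neg (by positivity : (0:ℝ) ≤ 4 * k),
            div_inv_eq_mul]
    have h4 : C * cellErr β q ≤ D * ((4 * k₀) ^ p * 2 * rho β n) := by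
      calc C * cellErr β q ≤ C * ((2 / β) ^ p * (q : ℝ) ^ (-p)) :=
            mul_le_mul_of_nonneg_left h2 hC.le
        _ = D * (q : ℝ) ^ (-p) := by rw [hD]; ring
        _ ≤ _ := mul_le_mul_of_nonneg_left (h3.trans hmain) hD0.le
    have h5 := rpow_le_rho hβ0 hn
    have h6 : 0 ≤ (4 * k₀) ^ p * 2 * rho β n := by positivity
    rw [← hpd] at h5
    linarith
  · -- here `n` is so small that the claimed bound exceeds the trivial one
    have h2 : |∫ x, (f x - g x) * ψ (orbit α n x) ∂unitVol| ≤ 2 := by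
      have hΨ : Measurable fun x => ψ (orbit α n x) := hψ.comp (measurable_orbit _ _)
      have h3 : |∫ x, (f x - g x) * ψ (orbit α n x) ∂unitVol| ≤ ∫ x, (f x + g x) ∂unitVol := by
        refine (abs_integral_le_integral_abs).trans (integral_mono_ae
          (integrable_mul_bdd (hf.integrable.sub hg.integrable) hΨ fun x => hψ1 _).abs
          (hf.integrable.add hg.integrable) ?_)
        filter_upwards [ae_unitVol_mem] with x hx
        have := hf.nonneg x hx
        have := hg.nonneg x hx
        rw [abs_mul]
        refine (mul_le_of_le_one_right (abs_nonneg _) (hψ1 _)).trans ?_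
        rw [abs_le]
        constructor <;> linarith
      rw [integral_add hf.integrable hg.integrable, hf1, hg1] at h3
      linarith
    have h3 : 1 ≤ (n : ℝ) ^ (-p) * (4 * k) ^ p := by
      have h4 : (n : ℝ) ≤ 4 * k := by
        have : n ≤ 4 * k := by omega
        exact_mod_cast this
      calc (1 : ℝ) = (n : ℝ) ^ (-p) * (n : ℝ) ^ p := by rw [← Real.rpow_add hn0]; simp
        _ ≤ _ := mul_le_mul_of_nonneg_left (Real.rpow_le_rpow hn0.le h4 hp.le) hX.le
    have h4 := h3.trans hmain
    have h5 : 0 ≤ D * ((4 * k₀) ^ p * 2 * rho β n) := by positivity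
    have h6 : 0 ≤ 2 * 2 ^ (1 / β) * rho β n := by positivity
    linarith

theorem Cone.const_mul {β c : ℝ} (hc : 0 ≤ c) {f : ℝ → ℝ} (hf : Cone β f) :
    Cone β fun x => c * f x where
  nonneg x hx := mul_nonneg hc (hf.nonneg x hx)
  anti x hx y hy h := mul_le_mul_of_nonneg_left (hf.anti hx hy h) hc
  mono x hx y hy h := by
    have := mul_le_mul_of_nonneg_left (hf.mono hx hy h) hc
    simp only at this ⊢
    linarith
  integrable := hf.integrable.const_mul c
  le_rpow x hx := by
    have := mul_le_mul_of_nonneg_left (hf.le_rpow x hx) hc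
    rw [integral_const_mul]
    linarith

theorem exists_memory_loss_of_mass {β : ℝ} (hβ0 : 0 < β) (hβ1 : β < 1) :
    ∃ C : ℝ, 0 < C ∧ ∀ α, Adm β α → ∀ n : ℕ, 2 ≤ n →
      ∀ f g, Cone β f → Cone β g → ∫ x, g x ∂unitVol = 1 →
      ∀ (ψ : ℝ → ℝ) (B : ℝ), Measurable ψ → (∀ x, |ψ x| ≤ B) →
      |∫ x, f x * ψ (orbit α n x) ∂unitVol -
          (∫ x, f x ∂unitVol) * ∫ x, g x * ψ (orbit α n x) ∂unitVol| ≤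
        C * (∫ x, f x ∂unitVol) * B * rho β n := by
  obtain ⟨C, hC, H⟩ := exists_memory_loss hβ0 hβ1
  refine ⟨C, hC, fun α hα n hn f g hf hg hg1 ψ B hψ hB => ?_⟩
  have hm := hf.integral_nonneg
  have hB0 : 0 ≤ B := (abs_nonneg _).trans (hB 0)
  have hΨ : Measurable fun x => ψ (orbit α n x) := hψ.comp (measurable_orbit _ _)
  set μ := ∫ x, f x ∂unitVol with hμ
  rcases hm.eq_or_lt with h0 | h0
  · have h1 : |∫ x, f x * ψ (orbit α n x) ∂unitVol| ≤ ∫ x, f x * B ∂unitVol := by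
      refine (abs_integral_le_integral_abs).trans (integral_mono_ae
        (integrable_mul_bdd hf.integrable hΨ fun x => hB _).abs (hf.integrable.mul_const B) ?_)
      filter_upwards [ae_unitVol_mem] with x hx
      rw [abs_mul, abs_of_nonneg (hf.nonneg x hx)]
      exact mul_le_mul_of_nonneg_left (hB _) (hf.nonneg x hx)
    rw [integral_mul_const, ← hμ, ← h0, zero_mul] at h1
    rw [← h0, abs_nonpos_iff.1 h1]
    simp
  rcases hB0.eq_or_lt with hb | hb
  · have : ∀ x, ψ x = 0 := fun x => abs_nonpos_iff.1 (hb ▸ hB x)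
    simp [this, ← hb]
  · have h1 := H α hα n hn (fun x => μ⁻¹ * f x) g (hf.const_mul (by positivity)) hg
      (by rw [integral_const_mul, ← hμ, inv_mul_cancel₀ h0.ne']) hg1 (fun x => B⁻¹ * ψ x)
      (hψ.const_mul _) (fun x => by
        rw [abs_mul, abs_of_pos (inv_pos.2 hb), inv_mul_le_one₀ hb]; exact hB x)
    have e : ∫ x, (μ⁻¹ * f x - g x) * (B⁻¹ * ψ (orbit α n x)) ∂unitVol =
        μ⁻¹ * B⁻¹ * (∫ x, f x * ψ (orbit α n x) ∂unitVol -
          μ * ∫ x, g x * ψ (orbit α n x) ∂unitVol) := by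
      rw [← integral_const_mul, ← integral_sub (integrable_mul_bdd hf.integrable hΨ fun x => hB _)
        ((integrable_mul_bdd hg.integrable hΨ fun x => hB _).const_mul _), ← integral_const_mul]
      congr 1
      ext x
      field_simp
    rw [e, abs_mul, abs_of_pos (by positivity), ← mul_inv, inv_mul_le_iff₀ (by positivity)] at h1
    linarith

/-! ### Correlations across a single gap -/

/-- Decorrelation across a gap of length `m` after time `t`. The cells of prefix length `t + m / 4`
are so short at the times `n i ≤ t` that the first argument of `K` may be frozen on them, and the
density transported to the end of a cell lies in the cone again. -/
theorem exists_gap_bound {β : ℝ} (hβ0 : 0 < β) (hβ1 : β < 1) :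
    ∃ C : ℝ, 0 < C ∧ ∀ α, Adm β α → ∀ f g, Cone β f → Cone β g →
      ∫ x, f x ∂unitVol = 1 → ∫ x, g x ∂unitVol = 1 →
      ∀ (t m M : ℕ) (S : Finset ℕ) (n : ℕ → ℕ), (∀ i ∈ S, n i ≤ t) →
      (∀ v, (S.filter fun i => n i = v).card ≤ M) →
      ∀ (K : ℝ → ℝ → ℝ) (B Λ : ℝ), Measurable (Function.uncurry K) → (∀ x z, |K x z| ≤ B) → 0 ≤ Λ →
      (∀ x ∈ Icc (0 : ℝ) 1, ∀ y ∈ Icc (0 : ℝ) 1, ∀ z,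
        |K x z - K y z| ≤ Λ * ∑ i ∈ S, |orbit α (n i) x - orbit α (n i) y|) →
      |∫ x, f x * K x (orbit α (t + m) x) ∂unitVol -
          ∫ x, f x * ∫ y, g y * K x (orbit α (t + m) y) ∂unitVol ∂unitVol| ≤
        C * (B + M * Λ) * rho β m := by
  obtain ⟨C, hC, H⟩ := exists_memory_loss_of_mass hβ0 hβ1
  have hp := exponent_pos hβ0 hβ1
  have hA := coneConst_ge hβ1
  have hb : 0 < 1 - β := by linarith
  set p := 1 / β - 1 with hpd
  set c₁ : ℝ := 8 ^ p * 2 ^ (1 / β) with hc₁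
  set c₂ : ℝ := (2 / β) ^ (1 / β) * (2 ^ (1 / β) / p) with hc₂
  set c₃ : ℝ := coneConst β / (1 - β) * (2 / β) ^ p with hc₃
  refine ⟨2 * (4 ^ p * 2 ^ (1 / β)) + 2 * c₂ * c₁ + C * 2 ^ p + 2 * c₃ * c₁, by positivity, ?_⟩
  intro α hα f g hf hg hf1 hg1 t m M S n hn hM K B Λ hK hB hΛ hKL
  have hB0 : 0 ≤ B := (abs_nonneg _).trans (hB 0 0)
  have hrho := rho_pos β m
  set T := orbit α (t + m) with hT
  have hTm : Measurable T := measurable_orbit _ _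
  set E := fun x => ∫ y, g y * K x (T y) ∂unitVol with hE
  have hKx : ∀ x, Measurable (K x) := fun x => hK.comp measurable_prodMk_left
  have hgK : ∀ x, Integrable (fun y => g y * K x (T y)) unitVol := fun x =>
    integrable_mul_bdd hg.integrable ((hKx x).comp hTm) fun y => hB _ _
  have hEm : AEStronglyMeasurable E unitVol := by
    have h1 : AEStronglyMeasurable (fun z : ℝ × ℝ => g z.2 * K z.1 (T z.2))
        (unitVol.prod unitVol) := by
      apply AEStronglyMeasurable.mul
      · exact hg.integrable.aestronglyMeasurable.comp_snd
      · exact (hK.comp (measurable_fst.prodMk (hTm.comp measurable_snd))).aestronglyMeasurable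
    exact h1.integral_prod_right'
  have hEB : ∀ x, |E x| ≤ B := by
    intro x
    have h1 : |E x| ≤ ∫ y, g y * B ∂unitVol := by
      refine (abs_integral_le_integral_abs).trans (integral_mono_ae (hgK x).abs
        (hg.integrable.mul_const B) ?_)
      filter_upwards [ae_unitVol_mem] with y hy
      rw [abs_mul, abs_of_nonneg (hg.nonneg y hy)]
      exact mul_le_mul_of_nonneg_left (hB _ _) (hg.nonneg y hy)
    rwa [integral_mul_const, hg1, one_mul] at h1
  have hKm : Measurable fun x => K x (T x) := hK.comp (measurable_id.prodMk hTm)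
  have hfK : Integrable (fun x => f x * K x (T x)) unitVol :=
    integrable_mul_bdd hf.integrable hKm fun x => hB _ _
  have hfE : Integrable (fun x => f x * E x) unitVol :=
    hf.integrable.mul_bdd hEm (Filter.Eventually.of_forall hEB)
  set W := fun x => f x * K x (T x) - f x * E x with hW
  have hWi : Integrable W unitVol := hfK.sub hfE
  have hWB : ∀ x ∈ Ioc (0 : ℝ) 1, |W x| ≤ 2 * B * f x := by
    intro x hx
    have h0 := hf.nonneg x hx
    simp only [hW]
    rw [← mul_sub, abs_mul, abs_of_nonneg h0]
    have h1 := abs_sub (K x (T x)) (E x)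
    have h2 := mul_le_mul_of_nonneg_left (h1.trans (add_le_add (hB x (T x)) (hEB x))) h0
    linarith
  have hWB' : ∀ s : Set ℝ, |∫ x in s, W x ∂unitVol| ≤ 2 * B * ∫ x in s, f x ∂unitVol := by
    intro s
    rw [← integral_const_mul]
    refine (abs_integral_le_integral_abs).trans (integral_mono_ae hWi.abs.restrict
      (hf.integrable.const_mul _).restrict ?_)
    exact ae_restrict_of_ae (ae_unitVol_mem.mono hWB)
  rw [← integral_sub hfK hfE]
  change |∫ x, W x ∂unitVol| ≤ _
  have hMΛ : 0 ≤ M * Λ := by positivity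
  rcases le_or_gt m 4 with hm | hm
  · have h1 := hWB' univ
    rw [Measure.restrict_univ, hf1, mul_one] at h1
    have h2 := one_le_rho_of_le_four hβ0 hβ1 hm
    have h3 := mul_le_mul_of_nonneg_left h2 hB0
    have h4 : 0 ≤ (2 * c₂ * c₁ + C * 2 ^ p + 2 * c₃ * c₁) * (B + M * Λ) * rho β m := by positivity
    have h5 : 0 ≤ 2 * (4 ^ p * 2 ^ (1 / β)) * (M * Λ) * rho β m := by positivity
    rw [← hpd] at h3
    linarith
  set q := m / 4 with hq
  have hq1 : 1 ≤ q := by omega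
  have hq0 : (0 : ℝ) < q := by exact_mod_cast hq1
  have hqm : (q : ℝ) ^ (-p) ≤ c₁ * rho β m := by
    have h1 : (m : ℝ) / 8 ≤ q := by
      have : m ≤ q * 8 := by omega
      rw [div_le_iff₀ (by norm_num)]
      exact_mod_cast this
    have hm0 : (0 : ℝ) < m := by exact_mod_cast (by omega : 0 < m)
    calc (q : ℝ) ^ (-p) ≤ ((m : ℝ) / 8) ^ (-p) :=
          Real.rpow_le_rpow_of_nonpos (by positivity) h1 (by linarith)
      _ = 8 ^ p * (m : ℝ) ^ (-p) := by
          rw [Real.div_rpow hm0.le (by norm_num), Real.rpow_neg (by norm_num : (0 : ℝ) ≤ 8),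
            div_inv_eq_mul, mul_comm]
      _ ≤ 8 ^ p * (2 ^ (1 / β) * rho β m) :=
          mul_le_mul_of_nonneg_left (rpow_le_rho hβ0 (by omega)) (by positivity)
      _ = _ := by rw [hc₁]; ring
  -- the error of freezing the first argument on a cell
  set ω := Λ * (M * (c₂ * (q : ℝ) ^ (-p))) with hω
  have hfreeze : ∀ i : (Fin (t + q) → Bool) × ℕ, ∀ x ∈ Ioc (0 : ℝ) 1, ∀ y ∈ Ioc (0 : ℝ) 1,
      x ∈ cell α (t + q) i → y ∈ cell α (t + q) i → ∀ z, |K x z - K y z| ≤ ω := by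
    intro i x hx y hy hxi hyi z
    have hx' : x ∈ Icc (0 : ℝ) 1 := ⟨hx.1.le, hx.2⟩
    have hy' : y ∈ Icc (0 : ℝ) 1 := ⟨hy.1.le, hy.2⟩
    refine (hKL x hx' y hy' z).trans (mul_le_mul_of_nonneg_left ?_ hΛ)
    refine le_trans (Finset.sum_le_sum fun r hr => ?_) (sum_diamBound_le hβ0 hβ1 hq1 hn hM)
    have := hn r hr
    exact cell_dist_le hβ0 hβ1 hα (by omega) i hx' hy' hxi hyi
  have hcell : ∀ i : (Fin (t + q) → Bool) × Fin q,
      |∫ x in cell α (t + q) (i.1, i.2), W x ∂unitVol| ≤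
        (2 * ω + C * B * (2 ^ p * rho β m)) * ∫ x in cell α (t + q) (i.1, i.2), f x ∂unitVol := by
    rintro ⟨w, j⟩
    have hj := j.2
    set J := cell α (t + q) (w, (j : ℕ)) with hJ
    by_cases hne : ∃ y, y ∈ J ∧ y ∈ Ioc (0 : ℝ) 1
    swap
    · have hz : unitVol.restrict J = 0 := by
        rw [Measure.restrict_eq_zero, measure_eq_zero_iff_ae_notMem]
        filter_upwards [ae_unitVol_mem] with x hx hxJ
        exact hne ⟨x, hxJ, hx⟩
      simp [hz]
    obtain ⟨x₀, hx₀J, hx₀⟩ := hne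
    set W₀ := fun x => f x * K x₀ (T x) - f x * E x₀ with hW₀
    have hfK₀ : Integrable (fun x => f x * K x₀ (T x)) unitVol :=
      integrable_mul_bdd hf.integrable ((hKx x₀).comp hTm) fun x => hB _ _
    have hW₀i : Integrable W₀ unitVol := hfK₀.sub (hf.integrable.mul_const _)
    have hdiff : |∫ x in J, W x ∂unitVol - ∫ x in J, W₀ x ∂unitVol| ≤
        2 * ω * ∫ x in J, f x ∂unitVol := by
      rw [← integral_sub hWi.restrict hW₀i.restrict, ← integral_const_mul]
      refine (abs_integral_le_integral_abs).trans (integral_mono_ae (hWi.sub hW₀i).abs.restrict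
        (hf.integrable.const_mul _).restrict ?_)
      filter_upwards [ae_restrict_mem (measurableSet_cell α _ _), ae_restrict_of_ae ae_unitVol_mem]
        with x hxJ hx
      have h0 := hf.nonneg x hx
      have h1 := hfreeze (w, j) x hx x₀ hx₀ hxJ hx₀J
      have h2 : |E x - E x₀| ≤ ω := by
        have h3 : |E x - E x₀| ≤ ∫ y, g y * ω ∂unitVol := by
          simp only [hE]
          rw [← integral_sub (hgK x) (hgK x₀)]
          refine (abs_integral_le_integral_abs).trans (integral_mono_ae
            ((hgK x).sub (hgK x₀)).abs (hg.integrable.mul_const _) ?_)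
          filter_upwards [ae_unitVol_mem] with y hy
          have hgy := hg.nonneg y hy
          rw [← mul_sub, abs_mul, abs_of_nonneg hgy]
          exact mul_le_mul_of_nonneg_left (h1 _) hgy
        rwa [integral_mul_const, hg1, one_mul] at h3
      have h4 : W x - W₀ x = f x * ((K x (T x) - K x₀ (T x)) - (E x - E x₀)) := by
        simp only [hW, hW₀]; ring
      rw [h4, abs_mul, abs_of_nonneg h0]
      have h5 := abs_sub (K x (T x) - K x₀ (T x)) (E x - E x₀)
      have h6 := mul_le_mul_of_nonneg_left (h5.trans (add_le_add (h1 _) h2)) h0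
      linarith
    have hfrozen : |∫ x in J, W₀ x ∂unitVol| ≤
        C * (∫ x in J, f x ∂unitVol) * B * (2 ^ p * rho β m) := by
      obtain ⟨r, hr⟩ := Nat.exists_eq_add_of_le (show t + q + j + 1 ≤ t + m by omega)
      set N := t + q + (j : ℕ) + 1 with hN
      have hTr : ∀ x, T x = orbit (shift α N) r (orbit α N x) := by
        intro x
        rw [hT, hr, orbit_add]
      have hψ : Measurable fun x => K x₀ (orbit (shift α N) r x) :=
        (hKx x₀).comp (measurable_orbit _ _)
      have h1 : ∫ x in J, W₀ x ∂unitVol = ∫ x in J, f x * K x₀ (T x) ∂unitVol -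
          (∫ x in J, f x ∂unitVol) * E x₀ := by
        simp only [hW₀]
        rw [integral_sub hfK₀.restrict (hf.integrable.mul_const _).restrict, integral_mul_const]
      have h2 : ∫ x in J, f x * K x₀ (T x) ∂unitVol =
          ∫ x, br α (word (t + q) w j) f N x * K x₀ (orbit (shift α N) r x) ∂unitVol := by
        rw [integral_br hα _ _ _ fun x => K x₀ (orbit (shift α N) r x)]
        simp only [hTr]
        rfl
      have h3 : E x₀ = ∫ x, trN α g N x * K x₀ (orbit (shift α N) r x) ∂unitVol := by
        rw [integral_trN hβ1 hα hg N hψ fun x => hB _ _]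
        simp only [hE, hTr]
      have h4 : ∫ x, br α (word (t + q) w j) f N x ∂unitVol = ∫ x in J, f x ∂unitVol :=
        integral_br_one hα _ _ _
      have h5 := H (shift α N) (hα.shift N) r (by omega) _ _
        (cone_br_cell hβ0 hβ1 hα (t + q) (w, (j : ℕ)) hf.toTame) (hg.trN hβ1 hα N)
        (by rw [integral_trN_one hβ1 hα hg, hg1]) (K x₀) B (hKx x₀) (hB x₀)
      simp only at h5
      rw [← hN, h4, ← h2, ← h3, ← h1] at h5
      refine h5.trans (mul_le_mul_of_nonneg_left ?_ ?_)
      · exact rho_le_of_half hβ0 hβ1 (by omega) (by omega) (by omega)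
      · have : 0 ≤ ∫ x in J, f x ∂unitVol := integral_nonneg_of_ae
          (ae_restrict_of_ae (ae_unitVol_mem.mono fun x hx => hf.nonneg x hx))
        positivity
    have h := abs_sub_abs_le_abs_sub (∫ x in J, W x ∂unitVol) (∫ x in J, W₀ x ∂unitVol)
    linarith
  have s1 := integral_eq_sum_cell α (t + q) q hWi
  have s2 := sum_cell_le α (t + q) q hf.integrable hf.nonneg
  rw [hf1] at s2
  have s3 := Finset.sum_le_sum fun i (_ : i ∈ Finset.univ) => hcell i
  have s4 := Finset.abs_sum_le_sum_abs (fun i : (Fin (t + q) → Bool) × Fin q =>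
    ∫ x in cell α (t + q) (i.1, i.2), W x ∂unitVol) Finset.univ
  rw [← Finset.mul_sum] at s3
  have s5 : (2 * ω + C * B * (2 ^ p * rho β m)) *
      ∑ i : (Fin (t + q) → Bool) × Fin q, ∫ x in cell α (t + q) (i.1, i.2), f x ∂unitVol ≤
      2 * ω + C * B * (2 ^ p * rho β m) := by
    have : 0 ≤ ω := by positivity
    exact mul_le_of_le_one_right (by positivity) s2
  have s6 := hWB' (tail α (t + q) q)
  have s7 := hf.setIntegral_tail_le hβ0 hβ1 hα (t + q) hq1
  rw [hf1, mul_one] at s7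
  have s8 : ∫ x in tail α (t + q) q, f x ∂unitVol ≤ c₃ * (c₁ * rho β m) := by
    refine s7.trans ?_
    have h1 := cellErr_le hβ0 hβ1 q
    rw [cellErr] at h1
    calc _ ≤ coneConst β / (1 - β) * ((2 / β) ^ p * (q : ℝ) ^ (-p)) :=
          mul_le_mul_of_nonneg_left h1 (by positivity)
      _ = c₃ * (q : ℝ) ^ (-p) := by rw [hc₃]; ring
      _ ≤ _ := mul_le_mul_of_nonneg_left hqm (by positivity)
  have s9 : ω ≤ M * Λ * (c₂ * (c₁ * rho β m)) := by
    have h1 : M * Λ * (c₂ * (q : ℝ) ^ (-p)) ≤ M * Λ * (c₂ * (c₁ * rho β m)) :=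
      mul_le_mul_of_nonneg_left (mul_le_mul_of_nonneg_left hqm (by positivity)) hMΛ
    rw [hω]
    linarith
  have s10 := mul_le_mul_of_nonneg_left s8 (by linarith : 0 ≤ 2 * B)
  have s11 := abs_add_le (∑ i : (Fin (t + q) → Bool) × Fin q,
    ∫ x in cell α (t + q) (i.1, i.2), W x ∂unitVol) (∫ x in tail α (t + q) q, W x ∂unitVol)
  rw [s1]
  have p1 : 0 ≤ 2 * (4 ^ p * 2 ^ (1 / β)) * (B + M * Λ) * rho β m := by positivity
  have p2 : 0 ≤ 2 * c₂ * c₁ * B * rho β m := by positivity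
  have p3 : 0 ≤ C * 2 ^ p * (M * Λ) * rho β m := by positivity
  have p4 : 0 ≤ 2 * c₃ * c₁ * (M * Λ) * rho β m := by positivity
  linarith

/-! ### Transfer to the unit interval as a subtype -/

theorem integral_unitInterval (G : I → ℝ) :
    ∫ x, G x = ∫ x, G (projIcc 0 1 zero_le_one x) ∂unitVol := by
  rw [unitVol_eq_Icc]
  have h := integral_subtype_comap (μ := (volume : Measure ℝ)) (measurableSet_Icc (a := (0 : ℝ)) (b := 1))
    fun x => G (projIcc 0 1 zero_le_one x)
  simp only [projIcc_val] at h
  exact h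

theorem exists_cone_of_hasDensityInCone {β : ℝ} (hβ0 : 0 < β) (hβ1 : β < 1) {μ : Measure I}
    [IsProbabilityMeasure μ] (h : HasDensityInCone β μ) :
    ∃ f : ℝ → ℝ, Cone β f ∧ ∫ x, f x ∂unitVol = 1 ∧
      ∀ φ : I → ℝ, ∫ x, φ x ∂μ = ∫ x, f x * φ (projIcc 0 1 zero_le_one x) ∂unitVol := by
  obtain ⟨d, hd, hμ⟩ := h
  set f := fun x : ℝ => d (projIcc 0 1 zero_le_one x) with hf
  have hmem : ∀ x ∈ Ioc (0 : ℝ) 1, projIcc 0 1 zero_le_one x ∈ Ioc (0 : I) 1 ∧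
      ((projIcc 0 1 zero_le_one x : I) : ℝ) = x := by
    intro x hx
    have e := projIcc_of_mem zero_le_one (show x ∈ Icc (0 : ℝ) 1 from ⟨hx.1.le, hx.2⟩)
    rw [e]
    exact ⟨⟨Subtype.coe_lt_coe.1 hx.1, Subtype.coe_le_coe.1 hx.2⟩, rfl⟩
  have hm : ∀ x y : ℝ, x ≤ y → projIcc (0 : ℝ) 1 zero_le_one x ≤ projIcc 0 1 zero_le_one y :=
    fun x y hxy => monotone_projIcc _ hxy
  have hint : Integrable f unitVol := by
    have h1 := hd.integrable
    rw [unitVol_eq_Icc]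
    refine (integrableOn_iff_comap_subtypeVal measurableSet_Icc).2 ?_
    have e : f ∘ Subtype.val = d := by
      funext x
      simp only [hf, Function.comp_apply]
      exact congrArg d (projIcc_val zero_le_one x)
    rw [e]
    exact h1
  have hφ : ∀ φ : I → ℝ, ∫ x, φ x ∂μ =
      ∫ x, f x * φ (projIcc 0 1 zero_le_one x) ∂unitVol := by
    intro φ
    rw [hμ, integral_withDensity_eq_integral_toReal_smul₀
      hd.integrable.aestronglyMeasurable.aemeasurable.ennreal_ofReal
      (Filter.Eventually.of_forall fun _ => ENNReal.ofReal_lt_top), integral_unitInterval]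
    apply integral_congr_ae
    filter_upwards [ae_unitVol_mem] with x hx
    rw [ENNReal.toReal_ofReal (hd.nonneg _ (hmem x hx).1), smul_eq_mul]
  have h1 : ∫ x, f x ∂unitVol = 1 := by
    have := hφ fun _ => 1
    simpa using this.symm
  refine ⟨f, ⟨⟨fun x hx => hd.nonneg _ (hmem x hx).1, fun x hx y hy hxy =>
    hd.antitoneOn (hmem x hx).1 (hmem y hy).1 (hm x y hxy), fun x hx y hy hxy => ?_, hint⟩,
    fun x hx => ?_⟩, h1, hφ⟩
  · have h2 := hd.monotoneOn (hmem x hx).1 (hmem y hy).1 (hm x y hxy)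
    simp only [(hmem x hx).2, (hmem y hy).2] at h2
    have e : ∀ z ∈ Ioc (0 : ℝ) 1, z ^ 2 * f z = z ^ (1 - β) * (z ^ (β + 1) * f z) := by
      intro z hz
      rw [← mul_assoc, ← Real.rpow_add hz.1, show 1 - β + (β + 1) = ((2 : ℕ) : ℝ) by push_cast; ring,
        Real.rpow_natCast]
    simp only
    rw [e x hx, e y hy]
    have hx0 := hx.1
    apply mul_le_mul (Real.rpow_le_rpow hx.1.le hxy (by linarith)) h2
    · exact mul_nonneg (by positivity) (hd.nonneg _ (hmem x hx).1)
    · exact Real.rpow_nonneg hy.1.le _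
  · have h2 := hd.le_rpow _ (hmem x hx).1
    rw [(hmem x hx).2, integral_unitInterval] at h2
    refine h2.trans ?_
    change 2 ^ β * (2 + β) * x ^ (-β) * ∫ y, f y ∂unitVol ≤ _
    rw [h1, mul_one, mul_one]
    apply mul_le_mul_of_nonneg_right _ (Real.rpow_nonneg hx.1.le _)
    have h3 : (2 : ℝ) ^ β ≤ 2 := by
      calc (2 : ℝ) ^ β ≤ 2 ^ (1 : ℝ) := Real.rpow_le_rpow_of_exponent_le (by norm_num) hβ1.le
        _ = 2 := Real.rpow_one 2
    have := coneConst_ge hβ1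
    nlinarith

theorem coe_comp (α : ℕ → Ioo (0 : ℝ) 1) (n : ℕ) (x : I) :
    (comp α n x : ℝ) = orbit (fun m => (α m : ℝ)) n x := by
  induction n with
  | zero => rfl
  | succ n ih =>
    rw [orbit_succ, ← ih]
    rfl

theorem comp_add (α : ℕ → Ioo (0 : ℝ) 1) (m n : ℕ) (x : I) :
    comp α (m + n) x = comp (fun s => α (m + s)) n (comp α m x) := by
  induction n with
  | zero => rfl
  | succ n ih =>
    change pmMap _ (comp α (m + n) x) = pmMap _ (comp _ n (comp α m x))
    rw [ih]
    rfl

theorem measurable_comp (α : ℕ → Ioo (0 : ℝ) 1) (n : ℕ) : Measurable (comp α n) := by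
  have h : Measurable fun x : I => (comp α n x : ℝ) := by
    simp only [coe_comp]
    exact (measurable_orbit _ _).comp measurable_subtype_coe
  exact h.subtype_mk (h := fun x => (comp α n x).2)

/-- The bound across a single gap, for measures on the unit interval. -/
theorem exists_gap_bound_unitInterval {β : ℝ} (hβ0 : 0 < β) (hβ1 : β < 1) :
    ∃ C : ℝ, 0 < C ∧ ∀ α : ℕ → Ioo (0 : ℝ) 1, (∀ m, 1 ≤ m → (α m : ℝ) ≤ β) →
      ∀ (μ ν : Measure I) [IsProbabilityMeasure μ] [IsProbabilityMeasure ν],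
      HasDensityInCone β μ → HasDensityInCone β ν →
      ∀ (t m M : ℕ) (S : Finset ℕ) (n : ℕ → ℕ), (∀ i ∈ S, n i ≤ t) →
      (∀ v, (S.filter fun i => n i = v).card ≤ M) →
      ∀ (K : I → I → ℝ) (B Λ : ℝ), Measurable (Function.uncurry K) → (∀ x z, |K x z| ≤ B) → 0 ≤ Λ →
      (∀ x y z, |K x z - K y z| ≤ Λ * ∑ i ∈ S, |(comp α (n i) x : ℝ) - comp α (n i) y|) →
      |∫ x, K x (comp α (t + m) x) ∂μ - ∫ x, ∫ y, K x (comp α (t + m) y) ∂ν ∂μ| ≤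
        C * (B + M * Λ) * rho β m := by
  obtain ⟨C, hC, H⟩ := exists_gap_bound hβ0 hβ1
  refine ⟨C, hC, fun α hα μ ν _ _ hμ hν t m M S n hn hM K B Λ hK hB hΛ hKL => ?_⟩
  obtain ⟨f, hf, hf1, hfφ⟩ := exists_cone_of_hasDensityInCone hβ0 hβ1 hμ
  obtain ⟨g, hg, hg1, hgφ⟩ := exists_cone_of_hasDensityInCone hβ0 hβ1 hν
  set pr : ℝ → I := projIcc 0 1 zero_le_one with hpr
  have hprm : Measurable pr := continuous_projIcc.measurable
  have hmem : ∀ x ∈ Icc (0 : ℝ) 1, (pr x : ℝ) = x := fun x hx => by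
    rw [hpr, projIcc_of_mem zero_le_one hx]
  have hcomp : ∀ x ∈ Icc (0 : ℝ) 1, ∀ s,
      comp α s (pr x) = pr (orbit (fun m => (α m : ℝ)) s x) := by
    intro x hx s
    rw [← projIcc_val zero_le_one (comp α s (pr x)), coe_comp, hmem x hx]
  have h := H (fun m => (α m : ℝ)) (fun m hm => ⟨(α m).2.1, hα m hm⟩) f g hf hg hf1 hg1 t m M S n
    hn hM (fun x z => K (pr x) (pr z)) B Λ
    (hK.comp ((hprm.comp measurable_fst).prodMk (hprm.comp measurable_snd)))
    (fun x z => hB _ _) hΛ (fun x hx y hy z => by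
      have := hKL (pr x) (pr y) (pr z)
      simp only [coe_comp, hmem x hx, hmem y hy] at this
      exact this)
  rw [hfφ, hfφ]
  convert h using 3
  · apply integral_congr_ae
    filter_upwards [ae_unitVol_mem] with x hx
    rw [← hcomp x ⟨hx.1.le, hx.2⟩]
  · congr 1
    ext x
    rw [hgφ]
    congr 1
    apply integral_congr_ae
    filter_upwards [ae_unitVol_mem] with y hy
    rw [← hcomp y ⟨hy.1.le, hy.2⟩]

/-! ### Resampling coordinates of a product measure -/

theorem measurable_update_prod {ι : Type*} [DecidableEq ι] {X : Type*} [MeasurableSpace X]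
    (i : ι) :
    Measurable fun z : (ι → X) × X => Function.update z.1 i z.2 := by
  rw [measurable_pi_iff]
  intro j
  by_cases h : j = i
  · subst h
    simpa using measurable_snd
  · simp only [Function.update_of_ne h]
    exact (measurable_pi_apply j).comp measurable_fst

section Resample

variable {ι : Type*} [Fintype ι] [DecidableEq ι] {X : Type*} [MeasurableSpace X]

theorem map_update_pi (μ : ι → Measure X) [∀ j, IsProbabilityMeasure (μ j)] (i : ι) :
    ((Measure.pi μ).prod (μ i)).map (fun z => Function.update z.1 i z.2) = Measure.pi μ := by
  have hmeas := measurable_update_prod (X := X) i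
  refine (Measure.pi_eq fun s hs => ?_).symm
  rw [Measure.map_apply hmeas (MeasurableSet.univ_pi hs)]
  have hpre : (fun z : (ι → X) × X => Function.update z.1 i z.2) ⁻¹' univ.pi s =
      (univ.pi (Function.update s i univ)) ×ˢ s i := by
    ext ⟨x, u⟩
    simp only [mem_preimage, mem_univ_pi, mem_prod]
    constructor
    · intro h
      refine ⟨fun j => ?_, by simpa using h i⟩
      by_cases hj : j = i
      · subst hj; simp
      · have := h j
        rw [Function.update_of_ne hj] at this ⊢
        exact this
    · rintro ⟨h, h'⟩ j
      by_cases hj : j = i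
      · subst hj; simpa using h'
      · have := h j
        rw [Function.update_of_ne hj] at this ⊢
        exact this
  rw [hpre, Measure.prod_prod, Measure.pi_pi, ← Finset.mul_prod_erase _ _ (Finset.mem_univ i),
    ← Finset.mul_prod_erase Finset.univ (fun j => μ j (s j)) (Finset.mem_univ i)]
  simp only [Function.update_self, measure_univ, one_mul]
  rw [mul_comm]
  congr 1
  apply Finset.prod_congr rfl
  intro j hj
  rw [Function.update_of_ne (Finset.ne_of_mem_erase hj)]

theorem integrable_of_bdd {Y : Type*} [MeasurableSpace Y] {μ : Measure Y} [IsFiniteMeasure μ]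
    {φ : Y → ℝ} (hφ : Measurable φ) {B : ℝ} (hB : ∀ x, |φ x| ≤ B) : Integrable φ μ :=
  Integrable.of_bound hφ.aestronglyMeasurable B (Filter.Eventually.of_forall hB)

theorem integral_pi_update (μ : ι → Measure X) [∀ j, IsProbabilityMeasure (μ j)] (i : ι)
    {φ : (ι → X) → ℝ} (hφ : Measurable φ) {B : ℝ} (hB : ∀ x, |φ x| ≤ B) :
    ∫ x, φ x ∂Measure.pi μ = ∫ x, ∫ u, φ (Function.update x i u) ∂μ i ∂Measure.pi μ := by
  have hm := measurable_update_prod (X := X) i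
  conv_lhs => rw [← map_update_pi μ i]
  rw [integral_map hm.aemeasurable hφ.aestronglyMeasurable,
    integral_prod (fun z : (ι → X) × X => φ (Function.update z.1 i z.2))
      (integrable_of_bdd (hφ.comp hm) fun z => hB _)]

theorem abs_integral_le_of_bdd {Y : Type*} [MeasurableSpace Y] {μ : Measure Y}
    [IsProbabilityMeasure μ] {φ : Y → ℝ} {B : ℝ} (hB : ∀ x, |φ x| ≤ B) : |∫ x, φ x ∂μ| ≤ B := by
  have := norm_integral_le_of_norm_le_const (μ := μ) (f := φ) (Filter.Eventually.of_forall hB)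
  simpa using this

/-- Averages with respect to a product measure may be estimated by resampling two coordinates and
freezing the others. -/
theorem abs_integral_pi_le (μ : ι → Measure X) [∀ j, IsProbabilityMeasure (μ j)] (a b : ι)
    {φ : (ι → X) → ℝ} (hφ : Measurable φ) {B R : ℝ} (hB : ∀ x, |φ x| ≤ B)
    (h : ∀ x, |∫ u, ∫ v, φ (Function.update (Function.update x a u) b v) ∂μ b ∂μ a| ≤ R) :
    |∫ x, φ x ∂Measure.pi μ| ≤ R := by
  have hm : Measurable fun x => ∫ v, φ (Function.update x b v) ∂μ b := by
    have := (hφ.comp (measurable_update_prod (X := X) b)).stronglyMeasurable.integral_prod_right'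
      (ν := μ b)
    exact this.measurable
  rw [integral_pi_update μ b hφ hB, integral_pi_update μ a hm
    fun x => abs_integral_le_of_bdd fun v => hB _]
  exact abs_integral_le_of_bdd h

end Resample

/-! ### Functions that are Lipschitz in some coordinates -/

theorem abs_sub_update_le {k : ℕ} {F : (Fin (k + 1) → I) → ℝ} {i : Fin (k + 1)}
    (h : LipschitzInCoord F i) (y : Fin (k + 1) → I) (a b : I) :
    |F (Function.update y i a) - F (Function.update y i b)| ≤ lipCoord F i * |(a : ℝ) - b| := by
  by_cases hab : a = b
  · simp [hab]
  have h0 : 0 < |(a : ℝ) - b| := abs_pos.2 (sub_ne_zero.2 fun e => hab (Subtype.ext e))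
  rw [← div_le_iff₀ h0]
  exact le_csSup h ⟨y, a, b, hab, rfl⟩

theorem lipCoord_le_maxLip {k q : ℕ} (F : (Fin (k + 1) → I) → ℝ) {i : Fin (k + 1)}
    (hi : (i : ℕ) ≤ q) : lipCoord F i ≤ maxLip F q :=
  le_ciSup (f := fun i : {i : Fin (k + 1) // (i : ℕ) ≤ q} => lipCoord F i)
    (Set.finite_range _).bddAbove ⟨i, hi⟩

theorem maxLip_nonneg {k q : ℕ} (F : (Fin (k + 1) → I) → ℝ) : 0 ≤ maxLip F q := by
  refine le_trans ?_ (lipCoord_le_maxLip F (i := 0) (Nat.zero_le q))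
  apply Real.sSup_nonneg
  rintro r ⟨y, a, b, -, rfl⟩
  positivity

theorem abs_sub_le_sum {k q : ℕ} {F : (Fin (k + 1) → I) → ℝ}
    (hF : ∀ i : Fin (k + 1), (i : ℕ) ≤ q → LipschitzInCoord F i) (S : Finset (Fin (k + 1)))
    (hS : ∀ i ∈ S, (i : ℕ) ≤ q) (y y' : Fin (k + 1) → I) (h : ∀ i ∉ S, y i = y' i) :
    |F y - F y'| ≤ maxLip F q * ∑ i ∈ S, |(y i : ℝ) - y' i| := by
  induction S using Finset.induction_on generalizing y with
  | empty =>
    have : y = y' := funext fun i => h i (by simp)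
    simp [this]
  | insert j S hj ih =>
    rw [Finset.sum_insert hj, mul_add]
    have h1 := ih (fun i hi => hS i (Finset.mem_insert_of_mem hi)) (Function.update y j (y' j))
      (fun i hi => by
        by_cases hij : i = j
        · subst hij; simp
        · rw [Function.update_of_ne hij]
          exact h i (by simp [hij, hi]))
    have h2 : ∑ i ∈ S, |((Function.update y j (y' j) i : I) : ℝ) - y' i| =
        ∑ i ∈ S, |(y i : ℝ) - y' i| := by
      apply Finset.sum_congr rfl
      intro i hi
      rw [Function.update_of_ne (ne_of_mem_of_not_mem hi hj)]
    rw [h2] at h1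
    have hjq := hS j (Finset.mem_insert_self _ _)
    have h3 := abs_sub_update_le (hF j hjq) y (y j) (y' j)
    rw [Function.update_eq_self] at h3
    have h4 := mul_le_mul_of_nonneg_right (lipCoord_le_maxLip F hjq) (abs_nonneg ((y j : ℝ) - y' j))
    have h5 := abs_sub_le (F y) (F (Function.update y j (y' j))) (F y')
    linarith

theorem abs_le_supNorm {k : ℕ} {F : (Fin (k + 1) → I) → ℝ} (hF : ∃ B, ∀ y, |F y| ≤ B)
    (y : Fin (k + 1) → I) : |F y| ≤ supNorm F := by
  obtain ⟨B, hB⟩ := hF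
  refine le_ciSup (f := fun y => |F y|) ⟨B, ?_⟩ y
  rintro _ ⟨z, rfl⟩
  exact hB z

/-! ### Blocks -/

theorem le_of_step {p : ℕ} {l : ℕ → ℕ} (hl : ∀ j, 1 ≤ j → j < p → l j < l (j + 1)) {i j : ℕ}
    (hi : 1 ≤ i) (hij : i ≤ j) (hj : j ≤ p) : l i ≤ l j := by
  induction j, hij using Nat.le_induction with
  | base => exact le_rfl
  | succ j hij ih =>
    have := ih (by omega)
    have := hl j (by omega) (by omega)
    omega

theorem le_block_iff {p : ℕ} {l : ℕ → ℕ} (hl : ∀ j, 1 ≤ j → j < p → l j < l (j + 1)) {i j : ℕ}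
    (h1 : 1 ≤ j) (hj : j ≤ p) : j ≤ (block p l i : ℕ) ↔ l j < i := by
  unfold block
  simp only
  constructor
  · intro h
    by_contra hc
    have hsub : (Finset.Icc 1 p).filter (fun j => l j < i) ⊆ Finset.Icc 1 (j - 1) := by
      intro r hr
      rw [Finset.mem_filter, Finset.mem_Icc] at hr
      rw [Finset.mem_Icc]
      refine ⟨hr.1.1, ?_⟩
      by_contra hr'
      have := le_of_step hl h1 (show j ≤ r by omega) hr.1.2
      omega
    have := Finset.card_le_card hsub
    rw [Nat.card_Icc] at this
    omega
  · intro h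
    have hsub : Finset.Icc 1 j ⊆ (Finset.Icc 1 p).filter (fun j => l j < i) := by
      intro r hr
      rw [Finset.mem_Icc] at hr
      rw [Finset.mem_filter, Finset.mem_Icc]
      have := le_of_step hl hr.1 hr.2 hj
      exact ⟨⟨hr.1, by omega⟩, by omega⟩
    have := Finset.card_le_card hsub
    rw [Nat.card_Icc] at this
    omega

theorem card_filter_le_timeMultiplicity (n : ℕ → ℕ) (p : ℕ) (l : ℕ → ℕ) (b : Fin (p + 1))
    {S : Finset ℕ} (hS : ∀ i ∈ S, i ≤ l p ∧ block p l i = b) (v : ℕ) :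
    (S.filter fun i => n i = v).card ≤ timeMultiplicity n p l := by
  rcases (S.filter fun i => n i = v).eq_empty_or_nonempty with h | ⟨i₀, h₀⟩
  · simp [h]
  rw [Finset.mem_filter] at h₀
  have hi₀ := hS i₀ h₀.1
  refine le_trans (Finset.card_le_card ?_) (Finset.le_sup (f := fun i =>
    ((Finset.range (l p + 1)).filter
      (fun i' => n i' = n i ∧ block p l i' = block p l i)).card)
    (Finset.mem_range.2 (show i₀ < l p + 1 by omega)))
  intro i hi
  rw [Finset.mem_filter] at hi
  have := hS i hi.1
  rw [Finset.mem_filter, Finset.mem_range]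
  exact ⟨by omega, by rw [hi.2, h₀.2], by rw [this.2, hi₀.2]⟩

/-- The interpolation between the two integrals: the blocks up to `j` use independent variables,
and the later blocks use the variable of block `j`. -/
noncomputable def interpolated {k : ℕ} (α : ℕ → Ioo (0 : ℝ) 1) (n : ℕ → ℕ) (p : ℕ) (l : ℕ → ℕ)
    (F : (Fin (k + 1) → I) → ℝ) (j : Fin (p + 1)) (x : Fin (p + 1) → I) : ℝ :=
  F fun i => comp α (n i) (x (min (block p l i) j))

theorem measurable_interpolated {k : ℕ} (α : ℕ → Ioo (0 : ℝ) 1) (n : ℕ → ℕ) (p : ℕ) (l : ℕ → ℕ)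
    {F : (Fin (k + 1) → I) → ℝ} (hF : Measurable F) (j : Fin (p + 1)) :
    Measurable (interpolated α n p l F j) :=
  hF.comp (measurable_pi_iff.2 fun i => (measurable_comp α (n i)).comp (measurable_pi_apply _))

end PomeauManneville

open PomeauManneville in
theorem theorem1p1 (β : ℝ) (hβ0 : 0 < β) (hβ1 : β < 1) :
    ∃ C : ℝ, 0 < C ∧
      ∀ (α : ℕ → Set.Ioo (0 : ℝ) 1), (∀ m, 1 ≤ m → (α m : ℝ) ≤ β) →
      ∀ (k p : ℕ) (n l : ℕ → ℕ),
        n 0 = 0 → (∀ i, i < k → n i ≤ n (i + 1)) →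
        1 ≤ p → 1 ≤ l 1 → (∀ j, 1 ≤ j → j < p → l j < l (j + 1)) → l p < k →
      ∀ (F : (Fin (k + 1) → unitInterval) → ℝ), Measurable F →
        (∃ B : ℝ, ∀ y, |F y| ≤ B) →
        (∀ i : Fin (k + 1), (i : ℕ) ≤ l p → PomeauManneville.LipschitzInCoord F i) →
      ∀ (μ : Fin (p + 1) → MeasureTheory.Measure unitInterval)
        [∀ j, MeasureTheory.IsProbabilityMeasure (μ j)],
        (∀ j, PomeauManneville.HasDensityInCone β (μ j)) →
        |(∫ x, PomeauManneville.composed α n p l F (fun _ => x) ∂(μ 0)) -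
            ∫ x, PomeauManneville.composed α n p l F x ∂(MeasureTheory.Measure.pi μ)| ≤
          C * (PomeauManneville.supNorm F +
              (PomeauManneville.timeMultiplicity n p l : ℝ) * PomeauManneville.maxLip F (l p)) *
            ∑ i ∈ Finset.Icc 1 p, PomeauManneville.rho β (n (l i + 1) - n (l i)) := by
  obtain ⟨C, hC, H⟩ := exists_gap_bound_unitInterval hβ0 hβ1
  refine ⟨C, hC, ?_⟩
  intro α hα k p n l _ hn hp _ hl hlk F hF hFB hFL μ _ hμ
  have hmono : ∀ i j, i ≤ j → j ≤ k → n i ≤ n j := by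
    intro i j hij hj
    induction j, hij using Nat.le_induction with
    | base => exact le_rfl
    | succ j _ ih => exact (ih (by omega)).trans (hn j (by omega))
  set R := supNorm F + (timeMultiplicity n p l : ℝ) * maxLip F (l p) with hR
  have hbd := abs_le_supNorm hFB
  have hstep : ∀ (j : ℕ) (hj : j < p),
      |∫ x, interpolated α n p l F ⟨j, by omega⟩ x ∂Measure.pi μ -
          ∫ x, interpolated α n p l F ⟨j + 1, by omega⟩ x ∂Measure.pi μ| ≤
        C * R * rho β (n (l (j + 1) + 1) - n (l (j + 1))) := by
    intro j hj
    set a : Fin (p + 1) := ⟨j, by omega⟩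
    set b : Fin (p + 1) := ⟨j + 1, by omega⟩
    have hab : a < b := Fin.mk_lt_mk.2 (Nat.lt_succ_self j)
    have hlp : l (j + 1) ≤ l p := le_of_step hl (by omega) (by omega) le_rfl
    set t := n (l (j + 1)) with ht
    set N := n (l (j + 1) + 1) with hN
    have htN : t ≤ N := hmono _ _ (by omega) (by omega)
    have hblock : ∀ i, a < block p l i ↔ l (j + 1) < i := fun i => by
      rw [← le_block_iff hl (by omega) (by omega), Fin.lt_def]
      exact Nat.succ_le_iff.symm
    rw [← integral_sub (integrable_of_bdd (measurable_interpolated α n p l hF a) fun x => hbd _)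
      (integrable_of_bdd (measurable_interpolated α n p l hF b) fun x => hbd _)]
    refine abs_integral_pi_le μ a b (B := 2 * supNorm F)
      ((measurable_interpolated α n p l hF a).sub (measurable_interpolated α n p l hF b))
      (fun x => ?_) fun x => ?_
    · have h1 := hbd fun i => comp α (n i) (x (min (block p l i) a))
      have h2 := hbd fun i => comp α (n i) (x (min (block p l i) b))
      refine (abs_sub _ _).trans ?_
      unfold interpolated
      linarith
    -- the function of the variable of block `j` and of the position at time `N`
    set K : I → I → ℝ := fun u z => F fun i =>
      if block p l i < a then comp α (n i) (x (block p l i))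
      else if block p l i = a then comp α (n i) u
      else comp (fun s => α (N + s)) (n i - N) z with hK
    have hlate : ∀ (i : Fin (k + 1)) (u : I), ¬ block p l i < a → block p l i ≠ a →
        comp α (n i) u = comp (fun s => α (N + s)) (n i - N) (comp α N u) := by
      intro i u h1 h2
      have h3 : l (j + 1) < i := (hblock i).1 (lt_of_le_of_ne (not_lt.1 h1) (Ne.symm h2))
      rw [← comp_add, Nat.add_sub_cancel' (hmono _ _ h3 (Nat.lt_succ_iff.1 i.2))]
    have e1 : ∀ u v, interpolated α n p l F a (Function.update (Function.update x a u) b v) =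
        K u (comp α N u) := by
      intro u v
      unfold interpolated
      rw [hK]
      congr 1
      funext i
      split_ifs with h1 h2
      · rw [min_eq_left h1.le, Function.update_of_ne (h1.trans hab).ne,
          Function.update_of_ne h1.ne]
      · rw [h2, min_self, Function.update_of_ne hab.ne, Function.update_self]
      · rw [min_eq_right (not_lt.1 h1), Function.update_of_ne hab.ne, Function.update_self,
          hlate i u h1 h2]
    have e2 : ∀ u v, interpolated α n p l F b (Function.update (Function.update x a u) b v) =
        K u (comp α N v) := by
      intro u v
      unfold interpolated
      rw [hK]
      congr 1
      funext i
      split_ifs with h1 h2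
      · rw [min_eq_left (h1.trans hab).le, Function.update_of_ne (h1.trans hab).ne,
          Function.update_of_ne h1.ne]
      · rw [h2, min_eq_left hab.le, Function.update_of_ne hab.ne, Function.update_self]
      · have h3 : b ≤ block p l i :=
          Fin.le_def.2 (Nat.succ_le_of_lt (Fin.lt_def.1 (lt_of_le_of_ne (not_lt.1 h1) (Ne.symm h2))))
        rw [min_eq_right h3, Function.update_self, hlate i v h1 h2]
    have hKm : Measurable (Function.uncurry K) := by
      refine hF.comp (measurable_pi_iff.2 fun i => ?_)
      by_cases h1 : block p l i < a
      · simp only [h1, if_true]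
        exact measurable_const
      by_cases h2 : block p l i = a
      · simp only [h2, lt_irrefl, if_false, if_true]
        exact (measurable_comp _ _).comp measurable_fst
      · simp only [h1, h2, if_false]
        exact (measurable_comp _ _).comp measurable_snd
    have hKb : ∀ u z, |K u z| ≤ supNorm F := fun u z => hbd _
    set S' : Finset (Fin (k + 1)) := Finset.univ.filter fun i => block p l i = a with hS'
    have hS'l : ∀ i ∈ S', (i : ℕ) ≤ l (j + 1) := by
      intro i hi
      by_contra hc
      exact ((hblock i).2 (not_le.1 hc)).ne' (Finset.mem_filter.1 hi).2
    set S : Finset ℕ := S'.map Fin.valEmbedding with hS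
    have hSmem : ∀ i ∈ S, i ≤ l (j + 1) ∧ block p l i = a := by
      intro i hi
      obtain ⟨i', hi', rfl⟩ := Finset.mem_map.1 hi
      exact ⟨hS'l i' hi', (Finset.mem_filter.1 hi').2⟩
    have hKL : ∀ u u' z, |K u z - K u' z| ≤
        maxLip F (l p) * ∑ i ∈ S, |(comp α (n i) u : ℝ) - comp α (n i) u'| := by
      intro u u' z
      rw [hS, Finset.sum_map]
      refine (abs_sub_le_sum hFL S' (fun i hi => (hS'l i hi).trans hlp) _ _ fun i hi => ?_).trans
        (le_of_eq ?_)
      · have h2 : block p l i ≠ a := fun h => hi (Finset.mem_filter.2 ⟨Finset.mem_univ _, h⟩)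
        simp only [h2, if_false]
      · congr 1
        apply Finset.sum_congr rfl
        intro i hi
        have h2 := (Finset.mem_filter.1 hi).2
        simp only [h2, lt_irrefl, if_false, if_true]
        rfl
    have h := H α hα (μ a) (μ b) (hμ a) (hμ b) t (N - t) (timeMultiplicity n p l) S n
      (fun i hi => hmono _ _ (hSmem i hi).1 (by omega))
      (card_filter_le_timeMultiplicity n p l a fun i hi => ⟨(hSmem i hi).1.trans hlp, (hSmem i hi).2⟩)
      K (supNorm F) (maxLip F (l p)) hKm hKb (maxLip_nonneg F) hKL
    rw [Nat.add_sub_cancel' htN] at h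
    simp only [Pi.sub_apply, e1, e2]
    have hmN := measurable_comp α N
    have hm2 : Measurable fun u => ∫ v, K u (comp α N v) ∂μ b :=
      ((hKm.comp (measurable_fst.prodMk (hmN.comp measurable_snd))).stronglyMeasurable
        |>.integral_prod_right' (ν := μ b)).measurable
    have e3 : ∀ u, ∫ v, (K u (comp α N u) - K u (comp α N v)) ∂μ b =
        K u (comp α N u) - ∫ v, K u (comp α N v) ∂μ b := by
      intro u
      have hm1 : Measurable fun v => K u (comp α N v) :=
        (hKm.comp measurable_prodMk_left).comp hmN
      rw [integral_sub (integrable_const _) (integrable_of_bdd hm1 fun v => hKb _ _)]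
      simp
    simp only [e3]
    have hm3 : Measurable fun u => K u (comp α N u) := hKm.comp (measurable_id.prodMk hmN)
    rw [integral_sub (integrable_of_bdd hm3 fun u => hKb _ _)
      (integrable_of_bdd hm2 fun u => abs_integral_le_of_bdd fun v => hKb _ _)]
    exact h
  have hsum : ∀ (j : ℕ) (hj : j ≤ p),
      |∫ x, interpolated α n p l F 0 x ∂Measure.pi μ -
          ∫ x, interpolated α n p l F ⟨j, by omega⟩ x ∂Measure.pi μ| ≤
        C * R * ∑ i ∈ Finset.Icc 1 j, rho β (n (l i + 1) - n (l i)) := by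
    intro j
    induction j with
    | zero => intro _; simp
    | succ j ih =>
      intro hj
      have h1 := ih (by omega)
      have h2 := hstep j (by omega)
      rw [Finset.sum_Icc_succ_top (by omega), mul_add]
      exact (abs_sub_le _ _ _).trans (add_le_add h1 h2)
  have hfirst : ∫ x, interpolated α n p l F 0 x ∂Measure.pi μ =
      ∫ x, composed α n p l F (fun _ => x) ∂μ 0 := by
    have hm : Measurable fun y : I => composed α n p l F fun _ => y :=
      hF.comp (measurable_pi_iff.2 fun i => measurable_comp α (n i))
    have h0 := measurePreserving_eval μ 0
    rw [← h0.map_eq, integral_map h0.measurable.aemeasurable hm.aestronglyMeasurable]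
    congr 1
    funext x
    unfold interpolated composed
    congr 1
    funext i
    rw [min_eq_right (Fin.zero_le _)]
  have hlast : ∫ x, interpolated α n p l F ⟨p, by omega⟩ x ∂Measure.pi μ =
      ∫ x, composed α n p l F x ∂Measure.pi μ := by
    congr 1
    funext x
    unfold interpolated composed
    congr 1
    funext i
    rw [min_eq_left (Fin.le_def.2 (Nat.lt_succ_iff.1 (block p l i).2))]
  have h := hsum p le_rfl
  rwa [hfirst, hlast] at h
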